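/- Let $p_0(t)=a_0+a_1t+a_2t^2+\cdots$ and $p_1(t)=b_0+b_1t+b_2t^2+\cdots$ be real polynomials with nonnegative coefficients, and let $p_0\neq 0$. The unfolding of the $1\times 2$ matrix $\begin{bmatrix}p_1 & p_0\end{bmatrix}$ is the infinite matrix $$M=\begin{bmatrix} b_0&a_0&b_1&a_1&b_2&a_2&\cdots\\ 0&0&b_0&a_0&b_1&a_1&\cdots\\ 0&0&0&0&b_0&a_0&\cdots\\ \vdots&\vdots&\vdots&\vdots&\vdots&\vdots&\ddots\end{bmatrix},$$ that is, for $i,d\ge 0$, the entry of $M$ in row $i$ and column $2d$ is $b_{d-i}$ and the entry in row $i$ and column $2d+1$ is $a_{d-i}$ (coefficients with negative index being $0$). Then $M$ is totally nonnegative (all its finite minors are nonnegative) if and only if $t^{\deg p_1}p_0(1/t)$ interlaces $t^{\deg p_1}p_1(1/t)$. Here a nonzero polynomial (or Laurent polynomial) is real-rooted if all its complex zeros (respectively, all its zeros in $\mathbb{C}\setminus\{0\}$) are real. A polynomial $f$ (weakly) interlaces a polynomial $g\neq0$ if both are real-rooted, $\deg f\in\{\deg g,\deg g+1\}$, and their roots,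 listed with multiplicity as $\chi_1\ge\chi_2\ge\cdots$ for $f$ and $\psi_1\ge\psi_2\ge\cdots$ for $g$, satisfy $\chi_1\ge\psi_1\ge\chi_2\ge\psi_2\ge\cdots$, ending with $\psi_{\deg g}$ if the degrees are equal and with $\chi_{\deg f}$ otherwise. By convention, every real-rooted polynomial or Laurent polynomial interlaces $0$. A Laurent polynomial that is not a polynomial interlaces no nonzero Laurent polynomial. If $p_1=0$, put $\deg p_1=0$. -/

import Mathlib

open scoped LaurentPolynomial

noncomputable section

/-- A (possibly infinite) real matrix is totally nonnegative if all its minors are nonnegative.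
A minor is given by `k` rows and `k` columns, both listed in increasing order. -/
def IsTotallyNonneg {α β : Type*} [LinearOrder α] [LinearOrder β] (M : Matrix α β ℝ) : Prop :=
  ∀ (k : ℕ) (r : Fin k ↪o α) (c : Fin k ↪o β), 0 ≤ (M.submatrix r c).det

/-- The unfolding of an `n × m` matrix `M` of formal Laurent series: the infinite block-Toeplitz
matrix (rows and columns indexed from `0`) whose block in block row `u` and block column `v` is
the matrix of coefficients of `t ^ (v - u)` in the entries of `M`. -/
def unfolding {n m : ℕ} [NeZero n] [NeZero m]
    (M : Matrix (Fin n) (Fin m) (LaurentSeries ℝ)) : Matrix ℕ ℕ ℝ :=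
  fun i j => (M (Fin.ofNat n i) (Fin.ofNat m j)).coeff (((j / m : ℕ) : ℤ) - ((i / n : ℕ) : ℤ))

/-- A real polynomial as a formal Laurent series. -/
def polyToSeries (p : Polynomial ℝ) : LaurentSeries ℝ :=
  HahnSeries.ofPowerSeries ℤ ℝ (p : PowerSeries ℝ)

/-- A polynomial is real-rooted if it is nonzero and all its complex roots are real, i.e. it is
a product of linear factors over `ℝ`. -/
def RealRooted (p : Polynomial ℝ) : Prop :=
  p ≠ 0 ∧ p.Splits

/-- The real roots of `p`, listed with multiplicity in weakly decreasing order. -/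
def rootList (p : Polynomial ℝ) : List ℝ :=
  p.roots.sort (· ≥ ·)

/-- `p` (weakly) interlaces `q`: either `q = 0` and `p` is real-rooted, or both are real-rooted
with `deg p = deg q` or `deg p = deg q + 1`, and the roots `χ₁ ≥ χ₂ ≥ …` of `p` and
`ψ₁ ≥ ψ₂ ≥ …` of `q` (with multiplicity) satisfy `χ₁ ≥ ψ₁ ≥ χ₂ ≥ ψ₂ ≥ …`. -/
def Interlaces (p q : Polynomial ℝ) : Prop :=
  (q = 0 ∧ RealRooted p) ∨
  (RealRooted p ∧ RealRooted q ∧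
    (p.natDegree = q.natDegree ∨ p.natDegree = q.natDegree + 1) ∧
    (∀ (i : ℕ) (hp : i < (rootList p).length) (hq : i < (rootList q).length),
      (rootList q)[i] ≤ (rootList p)[i]) ∧
    (∀ (i : ℕ) (hp : i + 1 < (rootList p).length) (hq : i < (rootList q).length),
      (rootList p)[i + 1] ≤ (rootList q)[i]))

/-- A Laurent polynomial is real-rooted if it is nonzero and all its zeros in `ℂ \ {0}` are real,
i.e. it is a power of `t` times a real-rooted polynomial. -/
def LaurentRealRooted (f : ℝ[T;T⁻¹]) : Prop :=
  ∃ (n : ℤ) (p : Polynomial ℝ), RealRooted p ∧ f = LaurentPolynomial.T n * p.toLaurent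

/-- Interlacing for Laurent polynomials: `f` interlaces `g` if `g = 0` and `f` is real-rooted, or
if `f` and `g` are both polynomials and `f` interlaces `g` as a polynomial. -/
def LaurentInterlaces (f g : ℝ[T;T⁻¹]) : Prop :=
  (g = 0 ∧ LaurentRealRooted f) ∨
  ∃ p q : Polynomial ℝ, p.toLaurent = f ∧ q.toLaurent = g ∧ Interlaces p q

/-- The Laurent polynomial `t ^ d * p(1 / t)`. -/
def reversal (d : ℕ) (p : Polynomial ℝ) : ℝ[T;T⁻¹] :=
  LaurentPolynomial.T (d : ℤ) * LaurentPolynomial.invert p.toLaurent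

end

open Polynomial Filter Topology

/-! The unfolding is `interleave p₁ p₀`: the Toeplitz columns of `p₁` and `p₀`, alternating.
Reversal inverts the negative roots, so the interlacing condition amounts to this: both polynomials
split, and on every half-line `[x, ∞)` the polynomial `p₁` has as many roots as `p₀` or one more
(`Alternates`).

Interlacing gives total nonnegativity by a Euclidean algorithm. If the roots of `f` and `g`
alternate, subtracting positive multiples of `X * g` from `f`, and then of the result from `g`,
lowers the degrees and keeps the alternation. Each subtraction is undone by adding a nonnegative
multiple of a column to its right neighbour, which preserves total nonnegativity. Weak interlacing
is a limit of strict interlacing.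

Conversely, merging neighbouring columns shows that every convex combination of `p₁` with `p₀`, or
of `p₁` with `X * p₀`, has a totally nonnegative Toeplitz matrix, and so is real-rooted
(`InitialMinorsNonneg.splits`). When all polynomials on a segment are real-rooted, the root counts
of its ends on a half-line differ by at most one (`countP_roots_lt_le`). The pair `p₀`, `p₁` gives
one inequality; the pair `p₁`, `X * p₀`, with its extra root at `0`, gives the other.

For real-rootedness, Gaussian elimination on Toeplitz rows amounts to power iteration for
multiplication by `-1/X` modulo `f`. Nonnegative minors make it converge, to `X * q` with `f = (X +
σ) * q`, and `q` inherits the nonnegative minors. -/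

/-- The Toeplitz matrix of a polynomial: row `i` lists the coefficients of `X ^ i * p`. -/
noncomputable def toeplitz (p : ℝ[X]) : Matrix ℕ ℕ ℝ := fun i d => (X ^ i * p).coeff d

/-- The matrix whose even columns are those of `toeplitz f` and whose odd columns are those of
`toeplitz g`. -/
noncomputable def interleave (f g : ℝ[X]) : Matrix ℕ ℕ ℝ :=
  fun i j => if j % 2 = 0 then toeplitz f i (j / 2) else toeplitz g i (j / 2)

/-! ### Total nonnegativity: column operations and limits -/

section TotallyNonneg

variable {α β γ : Type*} [LinearOrder α] [LinearOrder β] [LinearOrder γ]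

theorem IsTotallyNonneg.det_nonneg_of_monotone {A : Matrix α β ℝ} (hA : IsTotallyNonneg A)
    {k : ℕ} (r : Fin k ↪o α) {c : Fin k → β} (hc : Monotone c) :
    0 ≤ (A.submatrix r c).det := by
  by_cases h : Function.Injective c
  · exact hA k r (OrderEmbedding.ofStrictMono c (hc.strictMono_of_injective h))
  · simp only [Function.Injective, not_forall] at h
    obtain ⟨a, b, hab, hne⟩ := h
    rw [Matrix.det_zero_of_column_eq hne (fun i => by simp [hab])]

/-- Total nonnegativity is preserved when every column is replaced by a nonnegative combination of
two columns, with the pairs of columns chosen in increasing order. -/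
theorem IsTotallyNonneg.combine_columns {A : Matrix α β ℝ} (hA : IsTotallyNonneg A)
    {φ ψ : γ → β} {u v : γ → ℝ} (hu : ∀ j, 0 ≤ u j) (hv : ∀ j, 0 ≤ v j)
    (h₁ : ∀ j, φ j ≤ ψ j) (h₂ : ∀ j j', j < j' → ψ j ≤ φ j') :
    IsTotallyNonneg (fun i j => u j * A i (φ j) + v j * A i (ψ j) : Matrix α γ ℝ) := by
  intro k r c
  set m : Fin k → Fin k → ℝ := fun j i => u (c j) * A (r i) (φ (c j)) with hm
  set m' : Fin k → Fin k → ℝ := fun j i => v (c j) * A (r i) (ψ (c j)) with hm'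
  have key : (Matrix.submatrix (fun i j => u j * A i (φ j) + v j * A i (ψ j) : Matrix α γ ℝ)
      r c).det = Matrix.detRowAlternating (m + m') := by
    rw [← Matrix.det_transpose]; rfl
  -- Expand by multilinearity. Each term picks one of the two columns for every `j`; the picked
  -- columns increase weakly, so the determinant is zero or a minor of `A`.
  rw [key, AlternatingMap.map_add_univ]
  refine Finset.sum_nonneg fun s _ => ?_
  set χ : Fin k → β := fun j => if j ∈ s then φ (c j) else ψ (c j) with hχ
  set w : Fin k → ℝ := fun j => if j ∈ s then u (c j) else v (c j) with hw
  have e : Matrix.detRowAlternating (s.piecewise m m') =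
      (∏ j, w j) * (A.submatrix r χ).det := by
    rw [← Matrix.det_transpose (A.submatrix r χ), ← Matrix.det_mul_column]
    congr 1
    ext j i
    by_cases hj : j ∈ s <;> simp [hj, hm, hm', hw, hχ, Finset.piecewise]
  rw [e]
  refine mul_nonneg (Finset.prod_nonneg fun j _ => ?_) (hA.det_nonneg_of_monotone r ?_)
  · simp only [hw]; split_ifs
    exacts [hu _, hv _]
  · intro a b hab
    rcases hab.eq_or_lt with rfl | hlt
    · exact le_rfl
    have h3 := h₂ _ _ (c.strictMono hlt)
    have ha : χ a ≤ ψ (c a) := by simp only [hχ]; split_ifs <;> simp [h₁]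
    have hb : φ (c b) ≤ χ b := by simp only [hχ]; split_ifs <;> simp [h₁]
    exact ha.trans (h3.trans hb)

theorem IsTotallyNonneg.of_tendsto {ι : Type*} {l : Filter ι} [l.NeBot] {A : ι → Matrix α β ℝ}
    {B : Matrix α β ℝ} (h : ∀ i j, Tendsto (fun t => A t i j) l (𝓝 (B i j)))
    (hA : ∀ᶠ t in l, IsTotallyNonneg (A t)) : IsTotallyNonneg B := by
  intro k r c
  have h1 : Tendsto (fun t => ((A t).submatrix r c).det) l (𝓝 (B.submatrix r c).det) := by
    have h2 : Tendsto (fun t => (A t).submatrix r c) l (𝓝 (B.submatrix r c)) :=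
      tendsto_pi_nhds.2 fun i => tendsto_pi_nhds.2 fun j => h _ _
    exact ((continuous_id.matrix_det (n := Fin k) (R := ℝ)).tendsto _).comp h2
  exact ge_of_tendsto h1 (hA.mono fun t ht => ht k r c)

end TotallyNonneg

/-! ### Toeplitz matrices and their interleaving -/

section Toeplitz

theorem toeplitz_eq (p : ℝ[X]) (i d : ℕ) :
    toeplitz p i d = if i ≤ d then p.coeff (d - i) else 0 := by
  simp [toeplitz, coeff_X_pow_mul']

theorem toeplitz_add (p q : ℝ[X]) (i d : ℕ) :
    toeplitz (p + q) i d = toeplitz p i d + toeplitz q i d := by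
  simp [toeplitz, mul_add]

theorem toeplitz_C_mul (c : ℝ) (p : ℝ[X]) (i d : ℕ) :
    toeplitz (C c * p) i d = c * toeplitz p i d := by
  rw [toeplitz, mul_left_comm, coeff_C_mul, toeplitz]

theorem toeplitz_X_mul_succ (p : ℝ[X]) (i d : ℕ) :
    toeplitz (X * p) i (d + 1) = toeplitz p i d := by
  rw [toeplitz, mul_left_comm, coeff_X_mul, toeplitz]

theorem toeplitz_X_mul_zero (p : ℝ[X]) (i : ℕ) : toeplitz (X * p) i 0 = 0 := by
  rw [toeplitz, mul_left_comm, mul_coeff_zero]; simp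

theorem toeplitz_succ (p : ℝ[X]) (i d : ℕ) :
    toeplitz p (i + 1) d = toeplitz (X * p) i d := by
  rw [toeplitz, toeplitz, pow_succ, mul_assoc]

theorem toeplitz_succ_succ (p : ℝ[X]) (i d : ℕ) :
    toeplitz p (i + 1) (d + 1) = toeplitz p i d := by
  rw [toeplitz_succ, toeplitz_X_mul_succ]

theorem toeplitz_zero_left (p : ℝ[X]) (d : ℕ) : toeplitz p 0 d = p.coeff d := by
  simp [toeplitz]

theorem interleave_even (f g : ℝ[X]) (i d : ℕ) : interleave f g i (2 * d) = toeplitz f i d := by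
  simp [interleave]

theorem interleave_odd (f g : ℝ[X]) (i d : ℕ) :
    interleave f g i (2 * d + 1) = toeplitz g i d := by
  have h1 : (2 * d + 1) % 2 = 1 := by omega
  have h2 : (2 * d + 1) / 2 = d := by omega
  simp [interleave, h1, h2]

theorem interleave_ext {f g : ℝ[X]} {B : Matrix ℕ ℕ ℝ}
    (h₀ : ∀ i d, B i (2 * d) = toeplitz f i d) (h₁ : ∀ i d, B i (2 * d + 1) = toeplitz g i d) :
    interleave f g = B := by
  ext i j
  obtain ⟨d, rfl | rfl⟩ := Nat.even_or_odd' j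
  · rw [interleave_even, h₀]
  · rw [interleave_odd, h₁]

theorem isTotallyNonneg_interleave_add_right {f g : ℝ[X]} {c : ℝ} (hc : 0 ≤ c)
    (h : IsTotallyNonneg (interleave f g)) : IsTotallyNonneg (interleave f (g + C c * f)) := by
  have := h.combine_columns (φ := fun j => 2 * (j / 2)) (ψ := fun j => j)
    (u := fun j => if j % 2 = 0 then 0 else c) (v := fun _ => 1)
    (fun j => by split_ifs <;> simp [hc]) (fun _ => zero_le_one) (fun j => by omega)
    (fun j j' hj => by omega)
  rw [interleave_ext (B := _) ?_ ?_]
  · exact this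
  · intro i d; simp [interleave_even]
  · intro i d
    have h1 : (2 * d + 1) % 2 = 1 := by omega
    have h2 : (2 * d + 1) / 2 = d := by omega
    simp only [interleave_even, interleave_odd, h1, h2, toeplitz_add, toeplitz_C_mul]
    simp [add_comm]

/-- The factor `X` shifts the columns of `g` by one block, so column `2 * d` receives a multiple of
its left neighbour `2 * d - 1`. Column `0` has no left neighbour and gets weight `0`. -/
theorem isTotallyNonneg_interleave_add_left {f g : ℝ[X]} {c : ℝ} (hc : 0 ≤ c)
    (h : IsTotallyNonneg (interleave f g)) :
    IsTotallyNonneg (interleave (f + C c * (X * g)) g) := by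
  have := h.combine_columns (φ := fun j => 2 * ((j + 1) / 2) - 1) (ψ := fun j => j)
    (u := fun j => if j % 2 = 1 ∨ j = 0 then 0 else c) (v := fun _ => 1)
    (fun j => by split_ifs <;> simp [hc]) (fun _ => zero_le_one) (fun j => by omega)
    (fun j j' hj => by omega)
  rw [interleave_ext (B := _) ?_ ?_]
  · exact this
  · intro i d
    rcases d with _ | d
    · simp [toeplitz_add, toeplitz_C_mul, toeplitz_X_mul_zero,
        show interleave f g i 0 = toeplitz f i 0 from interleave_even f g i 0]
    · have h1 : 2 * ((2 * (d + 1) + 1) / 2) - 1 = 2 * d + 1 := by omega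
      have h2 : ¬ (2 * (d + 1) % 2 = 1 ∨ 2 * (d + 1) = 0) := by omega
      simp only [h1, h2, if_false, interleave_even, interleave_odd, toeplitz_add, toeplitz_C_mul,
        toeplitz_X_mul_succ]
      ring
  · intro i d
    have h1 : (2 * d + 1) % 2 = 1 := by omega
    simp [interleave_odd, h1]

theorem isTotallyNonneg_toeplitz_left {f g : ℝ[X]} (h : IsTotallyNonneg (interleave f g)) :
    IsTotallyNonneg (toeplitz f) := by
  have := h.combine_columns (φ := fun j : ℕ => 2 * j) (ψ := fun j => 2 * j)
    (u := fun _ => 1) (v := fun _ => 0)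
    (fun _ => zero_le_one) (fun _ => le_rfl) (fun j => le_rfl) (fun j j' hj => by omega)
  simpa [interleave_even] using this

theorem isTotallyNonneg_toeplitz_add {f g : ℝ[X]} {c c' : ℝ} (hc : 0 ≤ c) (hc' : 0 ≤ c')
    (h : IsTotallyNonneg (interleave f g)) :
    IsTotallyNonneg (toeplitz (C c * f + C c' * g)) := by
  have := h.combine_columns (φ := fun j : ℕ => 2 * j) (ψ := fun j => 2 * j + 1)
    (u := fun _ => c) (v := fun _ => c')
    (fun _ => hc) (fun _ => hc') (fun j => by omega) (fun j j' hj => by omega)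
  refine (congrArg IsTotallyNonneg ?_).mpr this
  ext i d
  simp [interleave_even, interleave_odd, toeplitz_add, toeplitz_C_mul]

/-- Merges columns `2 * d - 1` and `2 * d`, where `isTotallyNonneg_toeplitz_add` merges `2 * d` and
`2 * d + 1`. -/
theorem isTotallyNonneg_toeplitz_add_X_mul {f g : ℝ[X]} {c c' : ℝ} (hc : 0 ≤ c) (hc' : 0 ≤ c')
    (h : IsTotallyNonneg (interleave f g)) :
    IsTotallyNonneg (toeplitz (C c * f + C c' * (X * g))) := by
  have := h.combine_columns (φ := fun j : ℕ => 2 * j - 1) (ψ := fun j => 2 * j)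
    (u := fun j => if j = 0 then 0 else c') (v := fun _ => c)
    (fun j => by split_ifs <;> simp [hc']) (fun _ => hc) (fun j => by omega)
    (fun j j' hj => by omega)
  refine (congrArg IsTotallyNonneg ?_).mpr this
  ext i d
  rcases d with _ | d
  · simp [toeplitz_add, toeplitz_C_mul, toeplitz_X_mul_zero,
      show interleave f g i 0 = toeplitz f i 0 from interleave_even f g i 0]
  · have h1 : 2 * (d + 1) - 1 = 2 * d + 1 := by omega
    simp only [h1, interleave_even, interleave_odd, toeplitz_add, toeplitz_C_mul,
      toeplitz_X_mul_succ]
    simp [add_comm]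

theorem isTotallyNonneg_interleave_zero_right {f : ℝ[X]} (h : IsTotallyNonneg (toeplitz f)) :
    IsTotallyNonneg (interleave 0 f) := by
  have := h.combine_columns (φ := fun j : ℕ => j / 2) (ψ := fun j => j / 2)
    (u := fun j => if j % 2 = 0 then 0 else 1) (v := fun _ => 0)
    (fun j => by split_ifs <;> simp) (fun _ => le_rfl) (fun j => le_rfl)
    (fun j j' hj => by omega)
  rw [interleave_ext (B := _) ?_ ?_]
  · exact this
  · intro i d; simp [toeplitz]
  · intro i d
    have h1 : (2 * d + 1) % 2 = 1 := by omega
    have h2 : (2 * d + 1) / 2 = d := by omega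
    simp [h1, h2]

theorem isTotallyNonneg_toeplitz_right {f g : ℝ[X]} (h : IsTotallyNonneg (interleave f g)) :
    IsTotallyNonneg (toeplitz g) := by
  have := isTotallyNonneg_toeplitz_add (le_refl (0 : ℝ)) zero_le_one h
  simpa using this

/-- The end of the Euclidean algorithm. A minor has a zero row unless each chosen row has its one
possibly nonzero column chosen too; monotonicity then makes the submatrix diagonal. -/
theorem isTotallyNonneg_interleave_C_zero {a : ℝ} (ha : 0 ≤ a) :
    IsTotallyNonneg (interleave (C a) 0) := by
  have entry : ∀ i j, interleave (C a) 0 i j = if j = 2 * i then a else 0 := by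
    intro i j
    obtain ⟨d, rfl | rfl⟩ := Nat.even_or_odd' j
    · rw [interleave_even, toeplitz, coeff_mul_C, coeff_X_pow]
      simp
    · rw [interleave_odd, if_neg (by omega)]; simp [toeplitz]
  intro k r c
  by_cases h : ∀ i, ∃ j, c j = 2 * r i
  · choose b hb using h
    have hmono : StrictMono b := fun i i' hi => by
      have : c (b i) < c (b i') := by
        rw [hb, hb]; have := r.strictMono hi; omega
      exact c.strictMono.lt_iff_lt.1 this
    have hid : ∀ i, b i = i := fun i => by
      have h1 : Function.Surjective b := Finite.surjective_of_injective hmono.injective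
      exact congrFun ((hmono.range_inj strictMono_id).1 (by simp [h1.range_eq])) i
    have : (interleave (C a) 0).submatrix r c = Matrix.diagonal fun _ => a := by
      ext i j
      rw [Matrix.submatrix_apply, entry, Matrix.diagonal_apply]
      have h2 := hb i
      rw [hid] at h2
      rw [← h2]
      congr 1
      simp [eq_comm]
    rw [this, Matrix.det_diagonal]
    exact Finset.prod_nonneg fun _ _ => ha
  · push Not at h
    obtain ⟨i, hi⟩ := h
    rw [Matrix.det_eq_zero_of_row_eq_zero i]
    intro j
    rw [Matrix.submatrix_apply, entry, if_neg (hi j)]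

theorem unfolding_eq_interleave (p₀ p₁ : ℝ[X]) :
    unfolding (!![polyToSeries p₁, polyToSeries p₀] : Matrix (Fin 1) (Fin 2) (LaurentSeries ℝ)) =
      interleave p₁ p₀ := by
  have key : ∀ (p : ℝ[X]) (i d : ℕ), (polyToSeries p).coeff ((d : ℤ) - (i : ℤ)) =
      toeplitz p i d := by
    intro p i d
    rw [toeplitz_eq, polyToSeries]
    split_ifs with h
    · rw [← Nat.cast_sub h, HahnSeries.ofPowerSeries_apply_coeff]
      simp
    · rw [HahnSeries.ofPowerSeries_apply]
      refine HahnSeries.embDomain_of_notMem_range ?_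
      rintro ⟨n, hn⟩
      have : (n : ℤ) = d - i := hn
      omega
  symm
  refine interleave_ext ?_ ?_
  · intro i d
    have h1 : (2 * d) / 2 = d := by omega
    have h2 : Fin.ofNat 2 (2 * d) = 0 := by ext; simp [Fin.ofNat]
    have h3 : Fin.ofNat 1 i = 0 := Subsingleton.elim _ _
    rw [unfolding, ← key, h1, h2, h3]
    simp
  · intro i d
    have h1 : (2 * d + 1) / 2 = d := by omega
    have h2 : Fin.ofNat 2 (2 * d + 1) = 1 := by
      ext; simp [Fin.ofNat, Nat.add_mod]
    have h3 : Fin.ofNat 1 i = 0 := Subsingleton.elim _ _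
    rw [unfolding, ← key, h1, h2, h3]
    simp

end Toeplitz

/-! ### Sign alternation and the Euclidean algorithm -/

section Alternation

/-- The polynomial with leading coefficient `A` and roots `r 0, …, r (n - 1)`. -/
noncomputable def ofRoots (A : ℝ) (r : ℕ → ℝ) (n : ℕ) : ℝ[X] :=
  C A * ∏ k ∈ Finset.range n, (X - C (r k))

theorem eval_ofRoots (A : ℝ) (r : ℕ → ℝ) (n : ℕ) (x : ℝ) :
    (ofRoots A r n).eval x = A * ∏ k ∈ Finset.range n, (x - r k) := by
  simp [ofRoots, eval_prod]

theorem monic_prod_range_X_sub_C (r : ℕ → ℝ) (n : ℕ) :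
    (∏ k ∈ Finset.range n, (X - C (r k))).Monic :=
  monic_prod_of_monic _ _ fun k _ => monic_X_sub_C (r k)

theorem natDegree_prod_range_X_sub_C (r : ℕ → ℝ) (n : ℕ) :
    (∏ k ∈ Finset.range n, (X - C (r k))).natDegree = n := by
  rw [natDegree_prod_of_monic _ _ fun k _ => monic_X_sub_C (r k)]
  simp

theorem degree_ofRoots {A : ℝ} (hA : A ≠ 0) (r : ℕ → ℝ) (n : ℕ) :
    (ofRoots A r n).degree = n := by
  rw [ofRoots, degree_C_mul hA, degree_eq_natDegree (monic_prod_range_X_sub_C r n).ne_zero,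
    natDegree_prod_range_X_sub_C]

theorem leadingCoeff_ofRoots (A : ℝ) (r : ℕ → ℝ) (n : ℕ) :
    (ofRoots A r n).leadingCoeff = A := by
  rw [ofRoots, leadingCoeff_mul, (monic_prod_range_X_sub_C r n).leadingCoeff]
  simp

theorem eval_ofRoots_of_lt (A : ℝ) (r : ℕ → ℝ) {n k : ℕ} (hk : k < n) :
    (ofRoots A r n).eval (r k) = 0 := by
  rw [eval_ofRoots, Finset.prod_eq_zero (Finset.mem_range.2 hk) (sub_self _), mul_zero]

/-- The sign of a polynomial at a point separating its first `k` roots from the others. -/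
theorem neg_one_pow_mul_eval_ofRoots_pos {A : ℝ} (hA : 0 < A) {r : ℕ → ℝ} {n k : ℕ} (hk : k ≤ n)
    {x : ℝ} (h₁ : ∀ i < k, x < r i) (h₂ : ∀ i, k ≤ i → i < n → r i < x) :
    0 < (-1) ^ k * (ofRoots A r n).eval x := by
  obtain ⟨m, rfl⟩ := Nat.exists_eq_add_of_le hk
  rw [eval_ofRoots, Finset.prod_range_add]
  have e1 : (-1 : ℝ) ^ k * ∏ i ∈ Finset.range k, (x - r i) =
      ∏ i ∈ Finset.range k, (r i - x) := by
    have : ((-1 : ℝ)) ^ k = ∏ i ∈ Finset.range k, (-1 : ℝ) := by simp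
    rw [this, ← Finset.prod_mul_distrib]
    exact Finset.prod_congr rfl fun i _ => by ring
  have e2 : (-1 : ℝ) ^ k * (A * ((∏ i ∈ Finset.range k, (x - r i)) *
      ∏ i ∈ Finset.range m, (x - r (k + i)))) =
      A * ((∏ i ∈ Finset.range k, (r i - x)) * ∏ i ∈ Finset.range m, (x - r (k + i))) := by
    rw [← e1]; ring
  rw [e2]
  refine mul_pos hA (mul_pos (Finset.prod_pos fun i hi => ?_) (Finset.prod_pos fun i hi => ?_))
  · exact sub_pos.2 (h₁ i (Finset.mem_range.1 hi))
  · exact sub_pos.2 (h₂ _ (by omega) (by have := Finset.mem_range.1 hi; omega))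

theorem lt_of_succ_lt {u : ℕ → ℝ} {n : ℕ} (h : ∀ k, k + 1 < n → u (k + 1) < u k) {i j : ℕ}
    (hij : i < j) (hj : j < n) : u j < u i := by
  induction j, hij using Nat.le_induction with
  | base => exact h i hj
  | succ j hij ih => exact (h j hj).trans (ih (by omega))

theorem le_of_succ_lt {u : ℕ → ℝ} {n : ℕ} (h : ∀ k, k + 1 < n → u (k + 1) < u k) {i j : ℕ}
    (hij : i ≤ j) (hj : j < n) : u j ≤ u i := by
  rcases hij.eq_or_lt with rfl | h'
  · exact le_rfl
  · exact (lt_of_succ_lt h h' hj).le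

/-- A polynomial of degree at most `n` whose signs alternate at `n + 1` decreasing points is a
product of linear factors, with one root between any two consecutive points. -/
theorem exists_eq_ofRoots_of_alternating {n : ℕ} {p : ℝ[X]} {u : ℕ → ℝ}
    (hp : p.degree < ((n + 1 : ℕ) : WithBot ℕ)) (hu : ∀ k, k + 1 < n + 1 → u (k + 1) < u k)
    (hs : ∀ k < n + 1, 0 < (-1) ^ k * p.eval (u k)) :
    ∃ (s : ℕ → ℝ) (B : ℝ), 0 < B ∧ p = ofRoots B s n ∧
      ∀ k < n, u (k + 1) < s k ∧ s k < u k := by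
  -- The intermediate value theorem puts a root in each of the `n` gaps. Their product divides `p`,
  -- and the degree bound leaves a constant cofactor, whose sign is read off at `u 0`.
  have ex : ∀ k, ∃ x, k < n → (u (k + 1) < x ∧ x < u k) ∧ p.eval x = 0 := by
    intro k
    by_cases hk : k < n
    · have h1 := hs k (by omega)
      have h2 := hs (k + 1) (by omega)
      rw [pow_succ] at h2
      have hle := (hu k (by omega)).le
      have hc : ContinuousOn (fun x => p.eval x) (Set.Icc (u (k + 1)) (u k)) :=
        p.continuous.continuousOn
      rcases neg_one_pow_eq_or ℝ k with h | h <;> rw [h] at h1 h2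
      · obtain ⟨x, hx, hx'⟩ := intermediate_value_Ioo hle hc
          (show (0 : ℝ) ∈ Set.Ioo _ _ from ⟨by linarith, by linarith⟩)
        exact ⟨x, fun _ => ⟨hx, hx'⟩⟩
      · obtain ⟨x, hx, hx'⟩ := intermediate_value_Ioo' hle hc
          (show (0 : ℝ) ∈ Set.Ioo _ _ from ⟨by linarith, by linarith⟩)
        exact ⟨x, fun _ => ⟨hx, hx'⟩⟩
    · exact ⟨0, fun h => absurd h hk⟩
  choose s hs' using ex
  have hp0 : p ≠ 0 := by
    rintro rfl
    have := hs 0 (by omega)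
    simp at this
  have hlt : ∀ i j, i < j → j < n → s j < s i := fun i j hij hj =>
    lt_of_lt_of_le (hs' j hj).1.2 ((le_of_succ_lt hu hij (by omega)).trans
      (hs' i (by omega)).1.1.le)
  have hdvd : (∏ k ∈ Finset.range n, (X - C (s k))) ∣ p := by
    refine Finset.prod_dvd_of_coprime (fun i hi j hj hij => ?_) fun i hi => ?_
    · refine isCoprime_X_sub_C_of_isUnit_sub (sub_ne_zero.2 ?_).isUnit
      simp only [Finset.coe_range, Set.mem_Iio] at hi hj
      rcases lt_or_gt_of_ne hij with h | h
      · exact (hlt i j h hj).ne'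
      · exact (hlt j i h hi).ne
    · exact dvd_iff_isRoot.2 (hs' i (Finset.mem_range.1 hi)).2
  obtain ⟨q, hq⟩ := hdvd
  have hm := monic_prod_range_X_sub_C s n
  have hq0 : q ≠ 0 := by rintro rfl; simp at hq; exact hp0 hq
  have hdeg : q.natDegree = 0 := by
    have h1 : p.natDegree < n + 1 := (natDegree_lt_iff_degree_lt hp0).2 hp
    rw [hq, natDegree_mul hm.ne_zero hq0, natDegree_prod_range_X_sub_C] at h1
    omega
  obtain ⟨B, rfl⟩ := natDegree_eq_zero.1 hdeg
  have hpe : p = ofRoots B s n := by rw [hq, ofRoots, mul_comm]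
  refine ⟨s, B, ?_, hpe, fun k hk => (hs' k hk).1⟩
  have h0 := hs 0 (by omega)
  rw [hpe, eval_ofRoots, pow_zero, one_mul] at h0
  refine pos_of_mul_pos_left h0 (Finset.prod_nonneg fun i hi => sub_nonneg.2 ?_)
  have hi := Finset.mem_range.1 hi
  exact (hs' i hi).1.2.le.trans (le_of_succ_lt hu (Nat.zero_le i) (by omega))

theorem degree_sub_lt_of_leadingCoeff {p q : ℝ[X]} {n : ℕ} (hp : p.degree = n)
    (hq : q.degree = n) (h : p.leadingCoeff = q.leadingCoeff) : (p - q).degree < n := by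
  rw [← hp]
  refine degree_sub_lt_left (hp.trans hq.symm) ?_ h
  rintro rfl; simp at hp

/-- Induction through two division steps, `f' = f - (A / B) * X * g` and `g' = g - (B / A') * f'`.
Alternation survives because `f'` agrees with `f` at the roots of `g`, and `g'` with `g` at the
roots of `f'`. -/
theorem isTotallyNonneg_interleave_of_alternating (n : ℕ) : ∀ (A : ℝ) (r : ℕ → ℝ) (g : ℝ[X]),
    0 < A → (∀ k < n, r k < 0) → (∀ k, k + 1 < n → r (k + 1) < r k) → g.degree < n →
    (∀ k < n, 0 < (-1) ^ k * g.eval (r k)) →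
    IsTotallyNonneg (interleave (ofRoots A r n) g) := by
  induction n with
  | zero =>
    intro A r g hA _ _ hg _
    have : g = 0 := by
      rw [← degree_eq_bot]; exact (Nat.WithBot.lt_zero_iff).1 (by simpa using hg)
    subst this
    simpa [ofRoots] using isTotallyNonneg_interleave_C_zero hA.le
  | succ n ih =>
    intro A r g hA hr hr' hg hgs
    obtain ⟨s, B, hB, rfl, hs⟩ := exists_eq_ofRoots_of_alternating hg hr' hgs
    set f := ofRoots A r (n + 1) with hf
    set g := ofRoots B s n with hg_def
    set f' := f - C (A / B) * (X * g) with hf'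
    have hAB : A / B ≠ 0 := (div_pos hA hB).ne'
    have hdf : f'.degree < ((n + 1 : ℕ) : WithBot ℕ) := by
      refine degree_sub_lt_of_leadingCoeff (degree_ofRoots hA.ne' _ _) ?_ ?_
      · rw [degree_C_mul hAB, degree_mul, degree_X, degree_ofRoots hB.ne']
        push_cast; ring
      · rw [leadingCoeff_ofRoots, leadingCoeff_mul, leadingCoeff_mul, leadingCoeff_ofRoots]
        simp; field_simp
    -- The points `0, s 0, …, s (n - 1)`. At all of them `f'` agrees with `f`, which gives the `n +
    -- 1` alternating signs required; including `0` keeps the largest root of `f'` negative.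
    let u : ℕ → ℝ := fun k => Nat.casesOn k 0 s
    have hs0 : ∀ k < n, s k < 0 := fun k hk => (hs k hk).2.trans (hr k (by omega))
    have hss : ∀ k, k + 1 < n → s (k + 1) < s k := fun k hk =>
      (hs (k + 1) hk).2.trans (hs k (by omega)).1
    have hf's : ∀ k < n, f'.eval (s k) = f.eval (s k) := fun k hk => by
      simp [hf', hg_def, eval_ofRoots_of_lt B s hk]
    obtain ⟨r', A', hA', hfe, hr''⟩ := exists_eq_ofRoots_of_alternating (u := u) hdf
      (by
        rintro (_ | k) hk
        · exact hs0 0 (by omega)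
        · exact hss k (by omega))
      (by
        rintro (_ | k) hk
        · have : f'.eval 0 = f.eval 0 := by simp [hf']
          change 0 < (-1) ^ 0 * f'.eval 0
          rw [this]
          exact neg_one_pow_mul_eval_ofRoots_pos hA (Nat.zero_le _) (fun i hi => by omega)
            fun i _ hi => hr i hi
        · change 0 < (-1) ^ (k + 1) * f'.eval (s k)
          rw [hf's k (by omega)]
          refine neg_one_pow_mul_eval_ofRoots_pos hA hk.le (fun i hi => ?_) fun i hi hi' => ?_
          · exact (hs k (by omega)).2.trans_le (le_of_succ_lt hr' (by omega) (by omega))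
          · exact (le_of_succ_lt hr' hi hi').trans_lt (hs k (by omega)).1)
    have hr0 : ∀ k < n, s k < r' k := fun k hk => (hr'' k hk).1
    have hr1 : ∀ k, k + 1 < n → r' (k + 1) < s k := fun k hk => (hr'' (k + 1) hk).2
    have hr2 : ∀ k < n, r' k < 0 := by
      rintro (_ | k) hk
      · exact (hr'' 0 hk).2
      · exact (hr1 k hk).trans (hs0 k (by omega))
    set g' := g - C (B / A') * f' with hg'
    have hdg : g'.degree < n := by
      refine degree_sub_lt_of_leadingCoeff (degree_ofRoots hB.ne' _ _) ?_ ?_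
      · rw [degree_C_mul (div_pos hB hA').ne', hfe, degree_ofRoots hA'.ne']
      · rw [hfe, leadingCoeff_ofRoots, leadingCoeff_mul, leadingCoeff_ofRoots]
        simp; field_simp
    have main : IsTotallyNonneg (interleave f' g') := by
      rw [hfe]
      refine ih A' r' g' hA' hr2 (fun k hk => (hr1 k hk).trans (hr0 k (by omega))) hdg ?_
      intro k hk
      have : g'.eval (r' k) = g.eval (r' k) := by
        simp [hg', hfe, eval_ofRoots_of_lt A' r' hk]
      rw [this]
      refine neg_one_pow_mul_eval_ofRoots_pos hB hk.le (fun i hi => ?_) fun i hi hi' => ?_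
      · obtain ⟨k, rfl⟩ : ∃ m, k = m + 1 := ⟨k - 1, by omega⟩
        exact (hr1 k hk).trans_le (le_of_succ_lt hss (by omega) (by omega))
      · exact (le_of_succ_lt hss hi hi').trans_lt (hr0 k hk)
    have h1 := isTotallyNonneg_interleave_add_right (div_pos hB hA').le main
    rw [hg', sub_add_cancel] at h1
    have h2 := isTotallyNonneg_interleave_add_left (div_pos hA hB).le h1
    rwa [hf', sub_add_cancel] at h2

end Alternation

/-! ### From interlacing roots to total nonnegativity -/

section Interlacing

theorem continuous_coeff_ofRoots (A : ℝ) {ι : Type*} [TopologicalSpace ι] {r : ι → ℕ → ℝ}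
    (hr : ∀ k, Continuous fun t => r t k) (n d : ℕ) :
    Continuous fun t => (ofRoots A (r t) n).coeff d := by
  simp only [ofRoots, coeff_C_mul]
  refine continuous_const.mul ?_
  induction n generalizing d with
  | zero => simpa using continuous_const
  | succ n ih =>
    simp only [Finset.prod_range_succ]
    rcases d with _ | d
    · simp only [mul_coeff_zero, coeff_sub, coeff_X_zero, coeff_C_zero]
      exact (ih 0).mul (continuous_const.sub (hr n))
    · simp only [coeff_mul_X_sub_C]
      exact (ih d).sub ((ih (d + 1)).mul (hr n))

theorem continuous_toeplitz_ofRoots (A : ℝ) {ι : Type*} [TopologicalSpace ι] {r : ι → ℕ → ℝ}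
    (hr : ∀ k, Continuous fun t => r t k) (n i d : ℕ) :
    Continuous fun t => toeplitz (ofRoots A (r t) n) i d := by
  simp only [toeplitz_eq]
  split_ifs
  · exact continuous_coeff_ofRoots A hr n _
  · exact continuous_const

theorem isTotallyNonneg_interleave_of_strict {A B : ℝ} (hA : 0 < A) (hB : 0 < B) {n m : ℕ}
    (hm : m = n ∨ n = m + 1) {r s : ℕ → ℝ} (hr : ∀ k, r k < 0)
    (h₁ : ∀ k < n, k < m → s k < r k) (h₂ : ∀ k, k + 1 < n → k < m → r (k + 1) < s k) :
    IsTotallyNonneg (interleave (ofRoots A r n) (ofRoots B s m)) := by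
  have hrr : ∀ k, k + 1 < n → r (k + 1) < r k := fun k hk =>
    (h₂ k hk (by omega)).trans (h₁ k (by omega) (by omega))
  have hss : ∀ k, k + 1 < m → s (k + 1) < s k := fun k hk =>
    (h₁ (k + 1) (by omega) hk).trans (h₂ k (by omega) (by omega))
  have hsign : ∀ k < n, 0 < (-1) ^ k * (ofRoots B s m).eval (r k) := fun k hk => by
    refine neg_one_pow_mul_eval_ofRoots_pos hB (by omega) (fun i hi => ?_) fun i hi hi' => ?_
    · obtain ⟨k, rfl⟩ : ∃ m, k = m + 1 := ⟨k - 1, by omega⟩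
      exact (h₂ k hk (by omega)).trans_le (le_of_succ_lt hss (by omega) (by omega))
    · exact (le_of_succ_lt hss hi hi').trans_lt (h₁ k hk (by omega))
  rcases hm with rfl | rfl
  · have hBA := div_pos hB hA
    -- Cancelling the leading term does not change the values at the roots of `f`, so the signs
    -- there still alternate.
    set g' := ofRoots B s m - C (B / A) * ofRoots A r m with hg'
    have main : IsTotallyNonneg (interleave (ofRoots A r m) g') := by
      refine isTotallyNonneg_interleave_of_alternating m A r g' hA (fun k _ => hr k) hrr ?_ ?_
      · refine degree_sub_lt_of_leadingCoeff (degree_ofRoots hB.ne' _ _) ?_ ?_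
        · rw [degree_C_mul hBA.ne', degree_ofRoots hA.ne']
        · rw [leadingCoeff_mul, leadingCoeff_ofRoots, leadingCoeff_ofRoots]
          simp; field_simp
      · intro k hk
        simpa [hg', eval_ofRoots_of_lt A r hk] using hsign k hk
    have h1 := isTotallyNonneg_interleave_add_right hBA.le main
    rwa [hg', sub_add_cancel] at h1
  · exact isTotallyNonneg_interleave_of_alternating (m + 1) A r _ hA (fun k _ => hr k) hrr
      (by rw [degree_ofRoots hB.ne']; exact_mod_cast Nat.lt_succ_self m) hsign

/-- If the nonpositive roots of `f` and `g` interlace weakly, the largest root being one of `f`, then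
the matrix `interleave f g` is totally nonnegative. -/
theorem isTotallyNonneg_interleave_of_interlacing {A B : ℝ} (hA : 0 < A) (hB : 0 < B) {n m : ℕ}
    (hm : m = n ∨ n = m + 1) {r s : ℕ → ℝ} (hr : ∀ k, r k ≤ 0)
    (h₁ : ∀ k < n, k < m → s k ≤ r k) (h₂ : ∀ k, k + 1 < n → k < m → r (k + 1) ≤ s k) :
    IsTotallyNonneg (interleave (ofRoots A r n) (ofRoots B s m)) := by
  -- In the order `r 0, s 0, r 1, s 1, …` the roots move left by `ε, 2 * ε, 3 * ε, …`, so the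
  -- inequalities become strict and the roots negative.
  set r' : ℝ → ℕ → ℝ := fun ε k => r k - (2 * k + 1) * ε with hr'
  set s' : ℝ → ℕ → ℝ := fun ε k => s k - (2 * k + 2) * ε with hs'
  have hrc : ∀ k, Continuous fun ε => r' ε k := fun k => by simp only [hr']; fun_prop
  have hsc : ∀ k, Continuous fun ε => s' ε k := fun k => by simp only [hs']; fun_prop
  have hr0 : r' 0 = r := by ext k; simp [hr']
  have hs0 : s' 0 = s := by ext k; simp [hs']
  refine IsTotallyNonneg.of_tendsto (l := 𝓝[>] (0 : ℝ))
    (A := fun ε => interleave (ofRoots A (r' ε) n) (ofRoots B (s' ε) m)) ?_ ?_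
  · intro i j
    refine tendsto_nhdsWithin_of_tendsto_nhds ?_
    obtain ⟨d, rfl | rfl⟩ := Nat.even_or_odd' j
    · simp only [interleave_even]
      have := (continuous_toeplitz_ofRoots A hrc n i d).tendsto 0
      rwa [hr0] at this
    · simp only [interleave_odd]
      have := (continuous_toeplitz_ofRoots B hsc m i d).tendsto 0
      rwa [hs0] at this
  · filter_upwards [self_mem_nhdsWithin] with ε hε
    have hε : 0 < ε := hε
    refine isTotallyNonneg_interleave_of_strict hA hB hm (fun k => ?_) (fun k hk hk' => ?_)
      fun k hk hk' => ?_
    · have : 0 < (2 * (k : ℝ) + 1) * ε := by positivity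
      simp only [hr']; linarith [hr k]
    · simp only [hr', hs']; linarith [h₁ k hk hk']
    · simp only [hr', hs']; push_cast; linarith [h₂ k hk hk']

end Interlacing

/-! ### Eliminating rows of a Toeplitz matrix -/

section PolyaFrequency

/-- The minors of the Toeplitz matrix of `f` formed from its first rows are nonnegative. -/
def InitialMinorsNonneg (f : ℝ[X]) : Prop :=
  ∀ (n : ℕ) (κ : Fin n → ℕ), StrictMono κ →
    0 ≤ (Matrix.of fun i j : Fin n => toeplitz f i (κ j)).det

theorem initialMinorsNonneg_of_isTotallyNonneg {f : ℝ[X]} (h : IsTotallyNonneg (toeplitz f)) :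
    InitialMinorsNonneg f := fun n κ hκ =>
  h n (OrderEmbedding.ofStrictMono (fun i : Fin n => (i : ℕ)) Fin.val_strictMono)
    (OrderEmbedding.ofStrictMono κ hκ)

theorem InitialMinorsNonneg.coeff_nonneg {f : ℝ[X]} (h : InitialMinorsNonneg f) (k : ℕ) :
    0 ≤ f.coeff k := by
  have := h 1 (fun _ => k) (Subsingleton.strictMono _)
  simpa [toeplitz_zero_left] using this

theorem InitialMinorsNonneg.C_mul {f : ℝ[X]} (h : InitialMinorsNonneg f) {c : ℝ} (hc : 0 ≤ c) :
    InitialMinorsNonneg (C c * f) := by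
  intro n κ hκ
  have : (Matrix.of fun i j : Fin n => toeplitz (C c * f) i (κ j)) =
      c • (Matrix.of fun i j : Fin n => toeplitz f i (κ j)) := by
    ext i j; simp [toeplitz_C_mul]
  rw [this, Matrix.det_smul]
  exact mul_nonneg (pow_nonneg hc _) (h n κ hκ)

theorem InitialMinorsNonneg.of_X_mul {f : ℝ[X]} (h : InitialMinorsNonneg (X * f)) :
    InitialMinorsNonneg f := by
  intro n κ hκ
  have := h n (fun j => κ j + 1) (fun i j hij => Nat.succ_lt_succ (hκ hij))
  simpa only [toeplitz_X_mul_succ] using this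

/-- The rows `U 0, …, U (p - 1)` followed by the rows `1, 2, …` of `toeplitz f`. -/
noncomputable def stackedRows (f : ℝ[X]) (p : ℕ) (U : ℕ → ℕ → ℝ) (i c : ℕ) : ℝ :=
  if i < p then U i c else toeplitz f (i - p + 1) c

/-- Nonnegativity of the minors formed from the first rows in `stackedRows f p U`, omitting
column `0`. -/
def StackedMinorsNonneg (f : ℝ[X]) (p : ℕ) (U : ℕ → ℕ → ℝ) : Prop :=
  ∀ n, p ≤ n → ∀ κ : Fin n → ℕ, StrictMono κ → (∀ j, 1 ≤ κ j) →
    0 ≤ (Matrix.of fun i j : Fin n => stackedRows f p U i (κ j)).det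

/-- The effect of eliminating column `1` on a row stacked upon rows of `toeplitz f`. -/
def eliminate (f : ℝ[X]) (u : ℕ → ℝ) (j : ℕ) : ℝ := u 1 * f.coeff j - u (j + 1)

theorem det_eq_of_pivot {n : ℕ} (M : Matrix (Fin (n + 1)) (Fin (n + 1)) ℝ) (p : Fin (n + 1))
    (hp : M p 0 = 1) :
    M.det = (-1) ^ (p : ℕ) * (Matrix.of fun i j : Fin n =>
      M (p.succAbove i) j.succ - M (p.succAbove i) 0 * M p j.succ).det := by
  set N : Matrix (Fin (n + 1)) (Fin (n + 1)) ℝ :=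
    Matrix.of fun i j => M i j - (if i = p then 0 else M i 0) * M p j with hN
  have h1 : M.det = N.det := by
    refine Matrix.det_eq_of_forall_row_eq_smul_add_const (fun i => if i = p then 0 else M i 0) p
      (by simp) fun i j => ?_
    simp [hN]
  have h2 : ∀ i, N i 0 = if i = p then 1 else 0 := by
    intro i
    by_cases h : i = p
    · simp [hN, h, hp]
    · simp [hN, h, hp]
  rw [h1, Matrix.det_succ_column_zero, Finset.sum_eq_single p]
  · rw [h2, if_pos rfl, mul_one]
    congr 2
    ext i j
    simp [hN, Fin.succAbove_ne]
  · intro b _ hb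
    rw [h2, if_neg hb]; simp
  · simp

theorem prod_ite_lt_neg_one {n p : ℕ} (hp : p ≤ n) :
    ∏ i : Fin n, (if (i : ℕ) < p then (-1 : ℝ) else 1) = (-1) ^ p := by
  rw [Fin.prod_univ_eq_prod_range (fun i => if i < p then (-1 : ℝ) else 1) n]
  obtain ⟨m, rfl⟩ := Nat.exists_eq_add_of_le hp
  rw [Finset.prod_range_add]
  have h1 : ∏ i ∈ Finset.range p, (if i < p then (-1 : ℝ) else 1) = (-1) ^ p := by
    rw [Finset.prod_congr rfl fun i hi => if_pos (Finset.mem_range.1 hi)]; simp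
  rw [h1]; simp

/-- Add column `1` to the minor and pivot on row `1` of `toeplitz f`, whose entry there is `f.coeff
0 = 1`. Later Toeplitz rows vanish in that column and shift back to rows `1, 2, …`. The cofactor
sign `(-1) ^ p` is absorbed by negating the `p` stacked rows. -/
theorem StackedMinorsNonneg.eliminate {f : ℝ[X]} (hf : f.coeff 0 = 1) {p : ℕ}
    {U : ℕ → ℕ → ℝ} (h : StackedMinorsNonneg f p U) :
    StackedMinorsNonneg f p fun i => eliminate f (U i) := by
  intro n hn κ hκ hκ1
  set κ' : Fin (n + 1) → ℕ := Fin.cons 1 fun j => κ j + 1 with hκ'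
  have hmono : StrictMono κ' := by
    intro a b hab
    induction b using Fin.cases with
    | zero => exact absurd hab (Fin.not_lt_zero a)
    | succ b =>
      induction a using Fin.cases with
      | zero => have := hκ1 b; simp [hκ']; omega
      | succ a => simpa [hκ'] using hκ (Fin.succ_lt_succ_iff.1 hab)
  have h1 := h (n + 1) (by omega) κ' hmono (fun j => by
    induction j using Fin.cases <;> simp [hκ'])
  rw [det_eq_of_pivot _ ⟨p, by omega⟩ (by
    simp [stackedRows, hκ', toeplitz_eq, hf])] at h1
  rw [← prod_ite_lt_neg_one hn] at h1
  rw [← Matrix.det_mul_column] at h1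
  convert h1 using 2
  ext i j
  have hT : toeplitz f 1 (κ j + 1) = f.coeff (κ j) := by
    rw [toeplitz_succ_succ, toeplitz_zero_left]
  by_cases hi : (i : ℕ) < p
  · have hs : ((Fin.succAbove ⟨p, by omega⟩ i : Fin (n + 1)) : ℕ) = i := by
      rw [Fin.succAbove_of_castSucc_lt _ _ (by simpa [Fin.lt_def] using hi)]; simp
    simp [stackedRows, hi, hs, hκ', hT, _root_.eliminate]
  · have hs : ((Fin.succAbove ⟨p, by omega⟩ i : Fin (n + 1)) : ℕ) = i + 1 := by
      rw [Fin.succAbove_of_le_castSucc _ _ (by simpa [Fin.le_def] using not_lt.1 hi)]; simp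
    have hi' : ¬ ((i : ℕ) + 1 < p) := by omega
    have e : (i : ℕ) + 1 - p = (i : ℕ) - p + 1 := by omega
    have z : toeplitz f ((i : ℕ) - p + 1) 0 = 0 := by
      rw [toeplitz_eq, if_neg (by omega)]
    simp [stackedRows, hi, hi', hs, hκ', e, z, toeplitz_succ_succ]

theorem StackedMinorsNonneg.eliminate_iterate {f : ℝ[X]} (hf : f.coeff 0 = 1) {p : ℕ}
    {U : ℕ → ℕ → ℝ} (h : StackedMinorsNonneg f p U) (k : ℕ) :
    StackedMinorsNonneg f p fun i => (_root_.eliminate f)^[k] (U i) := by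
  induction k with
  | zero => exact h
  | succ k ih =>
    simp only [Function.iterate_succ_apply']
    exact ih.eliminate hf

theorem InitialMinorsNonneg.stacked_one {f : ℝ[X]} (h : InitialMinorsNonneg f) :
    StackedMinorsNonneg f 1 fun _ => f.coeff := by
  intro n _ κ hκ _
  convert h n κ hκ using 2
  ext i j
  simp only [stackedRows, Matrix.of_apply]
  split_ifs with hi
  · rw [show (i : ℕ) = 0 by omega, toeplitz_zero_left]
  · rw [show (i : ℕ) - 1 + 1 = i by omega]

/-- Shifting the columns by one frees rows `0` and `1` together for elimination; their 2-by-2 minors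
yield log-concavity. -/
theorem InitialMinorsNonneg.stacked_two {f : ℝ[X]} (h : InitialMinorsNonneg f) :
    StackedMinorsNonneg f 2 fun i c => f.coeff (c + 1 - i) := by
  intro n _ κ hκ _
  convert h n (fun j => κ j + 1) (fun i j hij => Nat.succ_lt_succ (hκ hij)) using 2
  ext i j
  simp only [stackedRows, Matrix.of_apply]
  split_ifs with hi
  · rw [toeplitz_eq, if_pos (by omega)]
  · rw [← toeplitz_succ_succ, show (i : ℕ) - 2 + 1 + 1 = i by omega]

theorem StackedMinorsNonneg.of_tendsto {f : ℝ[X]} {p : ℕ} {U : ℕ → ℕ → ℕ → ℝ}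
    {V : ℕ → ℕ → ℝ} (h : ∀ k, StackedMinorsNonneg f p (U k))
    (hV : ∀ i j, Tendsto (fun k => U k i j) atTop (𝓝 (V i j))) : StackedMinorsNonneg f p V := by
  intro n hn κ hκ hκ1
  have h1 : Tendsto (fun k => (Matrix.of fun i j : Fin n => stackedRows f p (U k) i (κ j)).det)
      atTop (𝓝 (Matrix.of fun i j : Fin n => stackedRows f p V i (κ j)).det) := by
    refine ((continuous_id.matrix_det (n := Fin n) (R := ℝ)).tendsto _).comp
      (tendsto_pi_nhds.2 fun i => tendsto_pi_nhds.2 fun j => ?_)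
    simp only [Matrix.of_apply, stackedRows]
    split_ifs
    · exact hV _ _
    · exact tendsto_const_nhds
  exact ge_of_tendsto' h1 fun k => h k n hn κ hκ hκ1

theorem StackedMinorsNonneg.smul {f : ℝ[X]} {u : ℕ → ℝ} {c : ℝ} (hc : 0 ≤ c)
    (h : StackedMinorsNonneg f 1 fun _ => u) :
    StackedMinorsNonneg f 1 fun _ j => c * u j := by
  intro n hn κ hκ hκ1
  have h1 := mul_nonneg hc (h n hn κ hκ hκ1)
  have h2 : ∏ i : Fin n, (if (i : ℕ) < 1 then c else 1) = c := by
    obtain ⟨m, rfl⟩ := Nat.exists_eq_add_of_le' hn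
    rw [Fin.prod_univ_succ]; simp
  rw [← h2, ← Matrix.det_mul_column] at h1
  refine h1.trans_eq (congrArg Matrix.det ?_)
  ext i j
  simp only [Matrix.of_apply, stackedRows]
  split_ifs <;> simp

theorem StackedMinorsNonneg.apply_nonneg {f : ℝ[X]} {u : ℕ → ℝ}
    (h : StackedMinorsNonneg f 1 fun _ => u) {j : ℕ} (hj : 1 ≤ j) : 0 ≤ u j := by
  have := h 1 le_rfl (fun _ => j) (Subsingleton.strictMono _) fun _ => hj
  simpa [stackedRows] using this

/-- If `f = (X + σ) * q`, the minors of `f` with the row of `X * q` on top are minors of `q`. -/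
theorem initialMinorsNonneg_of_stacked {f q : ℝ[X]} {σ : ℝ} (hf : f = (X + C σ) * q)
    (h : StackedMinorsNonneg f 1 fun _ => (X * q).coeff) : InitialMinorsNonneg q := by
  intro n κ hκ
  rcases n with _ | n
  · simp
  have h1 := h (n + 1) (by omega) (fun j => κ j + 1)
    (fun i j hij => Nat.succ_lt_succ (hκ hij)) (fun j => by omega)
  convert h1 using 1
  -- Since `X ^ (i + 1) * f = X * (X ^ (i + 1) * q) + σ * X * (X ^ i * q)`, successively subtracting
  -- `σ` times the row above leaves the shifted Toeplitz rows of `q`.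
  refine Matrix.det_eq_of_forall_row_eq_smul_add_pred (fun _ => -σ) (fun j => ?_)
    fun i j => ?_
  · simp [stackedRows, toeplitz_zero_left]
  · have e : X ^ (i + 1 : ℕ) * f = X * (X ^ (i + 1 : ℕ) * q) + C σ * (X * (X ^ (i : ℕ) * q)) := by
      rw [hf]; ring
    have e' : toeplitz f (i + 1 : ℕ) (κ j + 1) =
        toeplitz q (i + 1 : ℕ) (κ j) + σ * toeplitz q i (κ j) := by
      rw [toeplitz, e, coeff_add, coeff_X_mul, coeff_C_mul, coeff_X_mul, toeplitz, toeplitz]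
    simp [stackedRows, e']

end PolyaFrequency

/-! ### Splitting off linear factors by power iteration -/

section PolyaFrequencyRoots

/-- The rows obtained from the coefficients of `f` by repeated elimination. -/
noncomputable def reducedRow (f : ℝ[X]) (k : ℕ) : ℕ → ℝ := (eliminate f)^[k] f.coeff

theorem reducedRow_zero (f : ℝ[X]) : reducedRow f 0 = f.coeff := rfl

theorem reducedRow_succ (f : ℝ[X]) (k j : ℕ) :
    reducedRow f (k + 1) j = reducedRow f k 1 * f.coeff j - reducedRow f k (j + 1) := by
  rw [reducedRow, Function.iterate_succ_apply', eliminate, reducedRow]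

theorem reducedRow_eq_zero (f : ℝ[X]) (k : ℕ) {j : ℕ} (hj : f.natDegree < j) :
    reducedRow f k j = 0 := by
  induction k generalizing j with
  | zero => exact coeff_eq_zero_of_natDegree_lt hj
  | succ k ih => 
    rw [reducedRow_succ, ih (show f.natDegree < j + 1 by omega), coeff_eq_zero_of_natDegree_lt hj]
    ring

/-- From the first step on, rows read as polynomials are divisible by `X`. A further step sends `u`
to `u 1 * f - u / X`, which is `-u / X` modulo `f`. -/
theorem reducedRow_succ_zero {f : ℝ[X]} (hf : f.coeff 0 = 1) (k : ℕ) :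
    reducedRow f (k + 1) 0 = 0 := by
  rw [reducedRow_succ, hf]; ring

theorem iterate_eliminate_shift (f : ℝ[X]) (k j : ℕ) :
    (eliminate f)^[k] (fun c => f.coeff (c + 1)) j =
      f.coeff 1 * reducedRow f k j - reducedRow f (k + 1) j := by
  induction k generalizing j with
  | zero => rw [reducedRow_succ, reducedRow_zero]; simp
  | succ k ih =>
    rw [Function.iterate_succ_apply', eliminate, ih, ih]
    simp only [reducedRow_succ]
    ring

variable {f : ℝ[X]}

theorem InitialMinorsNonneg.stacked_reducedRow (h : InitialMinorsNonneg f) (hf : f.coeff 0 = 1)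
    (k : ℕ) : StackedMinorsNonneg f 1 fun _ => reducedRow f k :=
  h.stacked_one.eliminate_iterate hf k

theorem InitialMinorsNonneg.reducedRow_nonneg (h : InitialMinorsNonneg f) (hf : f.coeff 0 = 1)
    (k : ℕ) {j : ℕ} (hj : 1 ≤ j) : 0 ≤ reducedRow f k j :=
  (h.stacked_reducedRow hf k).apply_nonneg hj

/-- This is the minor in columns `1`, `2` of the two stacked rows after `k` eliminations, rewritten
by the recursion. -/
theorem InitialMinorsNonneg.reducedRow_one_logConcave (h : InitialMinorsNonneg f)
    (hf : f.coeff 0 = 1) (k : ℕ) :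
    reducedRow f k 1 * reducedRow f (k + 2) 1 ≤ reducedRow f (k + 1) 1 ^ 2 := by
  have h1 := (h.stacked_two.eliminate_iterate hf k) 2 le_rfl (fun j => j + 1)
    (fun i j hij => Nat.succ_lt_succ hij) (fun j => by omega)
  rw [Matrix.det_fin_two] at h1
  simp [stackedRows, iterate_eliminate_shift] at h1
  change (f.coeff 1 * reducedRow f k 2 - reducedRow f (k + 1) 2) * reducedRow f k 1 ≤
    (f.coeff 1 * reducedRow f k 1 - reducedRow f (k + 1) 1) * reducedRow f k 2 at h1
  have h2 := reducedRow_succ f k 1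
  have h3 := reducedRow_succ f (k + 1) 1
  have h4 : reducedRow f (k + 1) 2 = reducedRow f (k + 1) 1 * f.coeff 1 -
      reducedRow f (k + 2) 1 := by rw [h3]; ring
  have h5 : reducedRow f k 2 = reducedRow f k 1 * f.coeff 1 - reducedRow f (k + 1) 1 := by
    rw [h2]; ring
  rw [h4, h5] at h1
  nlinarith [h1]

/-- If the entry at `1` vanishes, nonnegativity of this row and the next forces every entry from `1`
on to vanish. The recursion carries this back to row `0`, contradicting the leading coefficient of
`f`. -/
theorem InitialMinorsNonneg.reducedRow_one_pos (h : InitialMinorsNonneg f)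
    (hf : f.coeff 0 = 1) (hn : 1 ≤ f.natDegree) (k : ℕ) : 0 < reducedRow f k 1 := by
  have hlead : f.coeff f.natDegree ≠ 0 := by
    rw [← leadingCoeff, Ne, leadingCoeff_eq_zero]; rintro rfl; simp at hn
  refine lt_of_le_of_ne (h.reducedRow_nonneg hf k le_rfl) fun h0 => ?_
  have h1 : ∀ j, 1 ≤ j → reducedRow f k j = 0 := by
    intro j hj
    obtain ⟨j, rfl⟩ : ∃ i, j = i + 1 := ⟨j - 1, by omega⟩
    rcases Nat.eq_zero_or_pos j with rfl | hj'
    · exact h0.symm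
    · have h2 := h.reducedRow_nonneg hf (k + 1) hj'
      have h3 := h.reducedRow_nonneg hf k hj
      rw [reducedRow_succ, ← h0] at h2
      linarith
  clear h0
  induction k with
  | zero => exact hlead (h1 _ hn)
  | succ k ih =>
    refine ih fun j hj => ?_
    have h2 : reducedRow f k 1 = 0 := by
      have h3 := h1 f.natDegree hn
      rw [reducedRow_succ, reducedRow_eq_zero f k (Nat.lt_succ_self _), sub_zero] at h3
      exact (mul_eq_zero.1 h3).resolve_right hlead
    obtain ⟨j, rfl⟩ : ∃ i, j = i + 1 := ⟨j - 1, by omega⟩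
    rcases Nat.eq_zero_or_pos j with rfl | hj'
    · exact h2
    · have h3 := h1 j hj'
      rw [reducedRow_succ, h2] at h3
      linarith

/-- The ratios increase by log-concavity. They are bounded because row `k + 2` is nonnegative at
index `natDegree - 1`, an index that is at least `1` only when the degree is at least `2`. -/
theorem InitialMinorsNonneg.exists_tendsto_ratio (h : InitialMinorsNonneg f)
    (hf : f.coeff 0 = 1) (hn : 2 ≤ f.natDegree) :
    ∃ σ, Tendsto (fun k => reducedRow f k 1 / reducedRow f (k + 1) 1) atTop (𝓝 σ) := by
  have hpos := h.reducedRow_one_pos hf (by omega : 1 ≤ f.natDegree)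
  have hlead : 0 < f.coeff f.natDegree := by
    refine lt_of_le_of_ne (h.coeff_nonneg _) fun h0 => ?_
    rw [← leadingCoeff, eq_comm, leadingCoeff_eq_zero] at h0
    subst h0; simp at hn
  refine ⟨_, tendsto_atTop_ciSup (monotone_nat_of_le_succ fun k => ?_)
    ⟨f.coeff (f.natDegree - 1) / f.coeff f.natDegree, ?_⟩⟩
  · rw [div_le_div_iff₀ (hpos _) (hpos _)]
    have := h.reducedRow_one_logConcave hf k
    nlinarith
  · rintro _ ⟨k, rfl⟩
    rw [div_le_div_iff₀ (hpos _) hlead]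
    obtain ⟨m, hm⟩ : ∃ m, f.natDegree = m + 1 := ⟨f.natDegree - 1, by omega⟩
    have h1 := h.reducedRow_nonneg hf (k + 2) (show 1 ≤ m by omega)
    rw [reducedRow_succ, reducedRow_succ f k (m + 1), reducedRow_eq_zero f k (j := m + 1 + 1) (by omega),
      ← hm] at h1
    rw [hm, Nat.add_sub_cancel, ← hm]
    linarith

/-- The normalised rows converge to some `v` with `f.coeff j = v j + σ * v (j + 1)` and `v 0 = 0`;
so `v` is `X * q`, and the minors pass to the limit. -/
theorem InitialMinorsNonneg.exists_factor (h : InitialMinorsNonneg f)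
    (hf : f.coeff 0 = 1) (hn : 2 ≤ f.natDegree) :
    ∃ (σ : ℝ) (q : ℝ[X]), f = (X + C σ) * q ∧ InitialMinorsNonneg q := by
  obtain ⟨σ, hσ⟩ := h.exists_tendsto_ratio hf hn
  have hpos := h.reducedRow_one_pos hf (by omega : 1 ≤ f.natDegree)
  -- Convergence descends from the index above the degree, where all rows vanish: the limit at `j +
  -- 1` yields the limit at `j`.
  have ex : ∀ i, ∃ v, Tendsto (fun k => (reducedRow f k 1)⁻¹ *
      reducedRow f (k + 1) (f.natDegree + 1 - i)) atTop (𝓝 v) := by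
    intro i
    induction i with
    | zero =>
      refine ⟨0, ?_⟩
      simp only [reducedRow_eq_zero f _ (j := f.natDegree + 1 - 0) (by omega), mul_zero]
      exact tendsto_const_nhds
    | succ i ih =>
      by_cases hi : i < f.natDegree + 1
      · obtain ⟨v, hv⟩ := ih
        refine ⟨f.coeff (f.natDegree + 1 - (i + 1)) - σ * v, ?_⟩
        rw [← tendsto_add_atTop_iff_nat 1]
        refine (tendsto_const_nhds.sub (hσ.mul hv)).congr fun k => ?_
        rw [reducedRow_succ f (k + 1), show f.natDegree + 1 - (i + 1) + 1 = f.natDegree + 1 - i by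
          omega]
        have := (hpos k).ne'
        have := (hpos (k + 1)).ne'
        field_simp
      · rw [show f.natDegree + 1 - (i + 1) = f.natDegree + 1 - i by omega]
        exact ih
  have ex' : ∀ j, ∃ v, Tendsto (fun k => (reducedRow f k 1)⁻¹ *
      reducedRow f (k + 1) j) atTop (𝓝 v) := by
    intro j
    rcases le_or_gt j (f.natDegree + 1) with hj | hj
    · have := ex (f.natDegree + 1 - j)
      rwa [Nat.sub_sub_self hj] at this
    · refine ⟨0, ?_⟩
      simp only [reducedRow_eq_zero f _ (j := j) (by omega), mul_zero]
      exact tendsto_const_nhds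
  choose v hv using ex'
  have hv0 : v 0 = 0 := by
    refine tendsto_nhds_unique (hv 0) ?_
    simp only [reducedRow_succ_zero hf, mul_zero]
    exact tendsto_const_nhds
  have hvn : ∀ j, f.natDegree < j → v j = 0 := fun j hj => by
    refine tendsto_nhds_unique (hv j) ?_
    simp only [reducedRow_eq_zero f _ hj, mul_zero]
    exact tendsto_const_nhds
  have hvs : ∀ j, f.coeff j = v j + σ * v (j + 1) := fun j => by
    have h1 : Tendsto (fun k => (reducedRow f (k + 1) 1)⁻¹ * reducedRow f (k + 1 + 1) j)
        atTop (𝓝 (f.coeff j - σ * v (j + 1))) := by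
      refine (tendsto_const_nhds.sub (hσ.mul (hv (j + 1)))).congr fun k => ?_
      rw [reducedRow_succ f (k + 1)]
      have := (hpos k).ne'
      have := (hpos (k + 1)).ne'
      field_simp
    have h2 := tendsto_nhds_unique ((tendsto_add_atTop_iff_nat 1).2 (hv j)) h1
    linarith
  set q : ℝ[X] := ∑ j ∈ Finset.range (f.natDegree + 1), C (v (j + 1)) * X ^ j with hq
  have hqc : ∀ j, q.coeff j = v (j + 1) := fun j => by
    simp only [hq, finsetSum_coeff, coeff_C_mul_X_pow]
    rw [Finset.sum_ite_eq]
    split_ifs with hj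
    · rfl
    · rw [hvn _ (by simp at hj; omega)]
  have hXq : (X * q).coeff = v := by
    ext j
    rcases j with _ | j
    · simp [hv0]
    · rw [coeff_X_mul, hqc]
  have hfq : f = (X + C σ) * q := by
    ext j
    rw [add_mul, coeff_add, coeff_C_mul, hqc, hXq, hvs]
  refine ⟨σ, q, hfq, initialMinorsNonneg_of_stacked hfq ?_⟩
  · rw [hXq]
    refine StackedMinorsNonneg.of_tendsto (U := fun k _ j => (reducedRow f k 1)⁻¹ *
      reducedRow f (k + 1) j) (fun k => ?_) fun _ j => hv j
    exact (h.stacked_reducedRow hf (k + 1)).smul (inv_nonneg.2 (hpos k).le)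

/-- A polynomial whose Toeplitz matrix is totally nonnegative is real-rooted
(Aissen–Schoenberg–Whitney). -/
theorem InitialMinorsNonneg.splits (h : InitialMinorsNonneg f) : f.Splits := by
  induction hn : f.natDegree using Nat.strong_induction_on generalizing f with
  | _ n ih =>
    rcases Nat.lt_or_ge f.natDegree 2 with h2 | h2
    · exact Splits.of_natDegree_le_one (by omega)
    have hf0 : f ≠ 0 := by rintro rfl; simp at h2
    by_cases h0 : f.coeff 0 = 0
    · obtain ⟨q, rfl⟩ := X_dvd_iff.2 h0
      have hq0 : q ≠ 0 := right_ne_zero_of_mul hf0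
      rw [natDegree_X_mul hq0] at hn
      exact Splits.X.mul (ih _ (by omega) h.of_X_mul rfl)
    · have hp : 0 < f.coeff 0 := lt_of_le_of_ne (h.coeff_nonneg 0) (Ne.symm h0)
      have hne : (f.coeff 0)⁻¹ ≠ 0 := inv_ne_zero h0
      obtain ⟨σ, q, hq, hqm⟩ := (h.C_mul (inv_nonneg.2 hp.le)).exists_factor
        (by simp [h0]) (by rwa [natDegree_C_mul hne])
      have hq0 : q ≠ 0 := by
        rintro rfl
        rw [mul_zero] at hq
        exact mul_ne_zero (C_ne_zero.2 hne) hf0 hq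
      have hdeg : f.natDegree = 1 + q.natDegree := by
        rw [← natDegree_C_mul hne, hq, natDegree_mul (X_add_C_ne_zero σ) hq0, natDegree_X_add_C]
      have h3 : (C (f.coeff 0)⁻¹ * f).Splits := by
        rw [hq]
        exact (Splits.X_add_C σ).mul (ih _ (by omega) hqm rfl)
      exact h3.of_dvd (mul_ne_zero (C_ne_zero.2 hne) hf0) (Dvd.intro_left _ rfl)

end PolyaFrequencyRoots

/-! ### Counting roots along a segment of real-rooted polynomials -/

section RootCounting

theorem eval_one_pos_of_coeff_nonneg {p : ℝ[X]} (hp : p ≠ 0) (h : ∀ k, 0 ≤ p.coeff k) :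
    0 < p.eval 1 := by
  rw [eval_eq_sum_range]
  refine Finset.sum_pos' (fun i _ => by simpa using h i) ⟨p.natDegree, by simp, ?_⟩
  have : p.coeff p.natDegree ≠ 0 := by simpa using hp
  simpa using lt_of_le_of_ne (h _) this.symm

theorem le_zero_of_mem_roots_of_coeff_nonneg {p : ℝ[X]} (h : ∀ k, 0 ≤ p.coeff k) {r : ℝ}
    (hr : r ∈ p.roots) : r ≤ 0 := by
  by_contra! hpos
  have hp : p ≠ 0 := ne_zero_of_mem_roots hr
  have h0 : p.eval r = 0 := isRoot_of_mem_roots hr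
  have : 0 < p.eval r := by
    rw [eval_eq_sum_range]
    refine Finset.sum_pos' (fun i _ => mul_nonneg (h i) (by positivity))
      ⟨p.natDegree, by simp, ?_⟩
    have : p.coeff p.natDegree ≠ 0 := by simpa using hp
    exact mul_pos (lt_of_le_of_ne (h _) this.symm) (by positivity)
  linarith

/-- The affine function taking the value `1` at `1`, with slope `y`. -/
def affineFactor (y t : ℝ) : ℝ := (1 - y) + y * t

/-- `p` is its value at `1` times the product of the affine functions with slopes `y`. -/
def HasAffineFactors (p : ℝ[X]) {d : ℕ} (y : Fin d → ℝ) : Prop :=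
  ∀ t, p.eval t = p.eval 1 * ∏ i, affineFactor (y i) t

/-- A root `r ≤ 0` gets slope `1 / (1 - r)` in `(0, 1]`, and slope `0` stands for a root at `-∞`.
The slopes thus stay in a compact cube even where the degree drops. -/
theorem exists_affineFactors_multiset (d : ℕ) : ∀ s : Multiset ℝ, s.card ≤ d →
    (∀ r ∈ s, r ≤ 0) → ∃ y : Fin d → ℝ, (∀ i, y i ∈ Set.Icc (0 : ℝ) 1) ∧
      ∀ t, (s.map fun r => t - r).prod =
        (s.map fun r => 1 - r).prod * ∏ i, affineFactor (y i) t := by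
  induction d with
  | zero =>
    intro s hs _
    obtain rfl : s = 0 := Multiset.card_eq_zero.1 (by omega)
    exact ⟨fun i => 0, fun i => by simp, fun t => by simp⟩
  | succ d ih =>
    intro s hs hs0
    rcases s.empty_or_exists_mem with rfl | ⟨r, hr⟩
    · exact ⟨fun i => 0, fun i => by simp, fun t => by simp [affineFactor]⟩
    · obtain ⟨s, rfl⟩ := Multiset.exists_cons_of_mem hr
      obtain ⟨y, hy, hy'⟩ := ih s (by simpa using hs) fun r hr => hs0 r (Multiset.mem_cons_of_mem hr)
      have hr0 : r ≤ 0 := hs0 r hr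
      have h1 : 0 < 1 - r := by linarith
      refine ⟨Fin.cons (1 - r)⁻¹ y, fun i => ?_, fun t => ?_⟩
      · induction i using Fin.cases with
        | zero => exact ⟨by simpa using h1.le, by simpa using inv_le_one_of_one_le₀ (by linarith)⟩
        | succ i => simpa using hy i
      · rw [Multiset.map_cons, Multiset.map_cons, Multiset.prod_cons, Multiset.prod_cons, hy',
          Fin.prod_univ_succ]
        simp only [Fin.cons_zero, Fin.cons_succ]
        have : t - r = (1 - r) * affineFactor (1 - r)⁻¹ t := by
          rw [affineFactor]; field_simp; ring
        rw [this]; ring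

theorem exists_hasAffineFactors {p : ℝ[X]} (hs : p.Splits) (h : ∀ k, 0 ≤ p.coeff k) {d : ℕ}
    (hd : p.natDegree ≤ d) :
    ∃ y : Fin d → ℝ, (∀ i, y i ∈ Set.Icc (0 : ℝ) 1) ∧ HasAffineFactors p y := by
  obtain ⟨y, hy, hy'⟩ := exists_affineFactors_multiset d p.roots
    ((card_roots' p).trans hd) fun r => le_zero_of_mem_roots_of_coeff_nonneg h
  refine ⟨y, hy, fun t => ?_⟩
  rw [hs.eval_eq_prod_roots, hs.eval_eq_prod_roots, hy', mul_assoc]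

theorem HasAffineFactors.countP_roots {p : ℝ[X]} (hp : p ≠ 0) {d : ℕ} {y : Fin d → ℝ}
    (h : HasAffineFactors p y) (P : ℝ → Prop) [DecidablePred P] (Q : ℝ → Prop) [DecidablePred Q]
    (h0 : ∀ i, y i = 0 → ¬ Q (y i)) (h1 : ∀ i, y i ≠ 0 → (Q (y i) ↔ P ((y i - 1) / y i))) :
    p.roots.countP P = (Finset.univ.filter fun i => Q (y i)).card := by
  have hpe : p = C (p.eval 1) * ∏ i, (C (y i) * X + C (1 - y i)) := by
    refine Polynomial.funext fun t => ?_
    rw [h t]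
    simp [eval_prod, affineFactor, add_comm]
  have hne : p.eval 1 ≠ 0 := fun h0 => hp (by rw [hpe, h0]; simp)
  have hne' : ∏ i, (C (y i) * X + C (1 - y i)) ≠ 0 := fun h0 => hp (by rw [hpe, h0]; simp)
  rw [hpe, roots_C_mul _ hne, roots_prod _ _ hne', Multiset.countP_eq_card_filter,
    Multiset.filter_bind, Multiset.card_bind, Finset.card_filter]
  change ∑ i, _ = _
  refine Finset.sum_congr rfl fun i _ => ?_
  rw [Function.comp_apply]
  by_cases hy : y i = 0
  · rw [if_neg (h0 i hy)]; simp [hy]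
  · have hr : (C (y i) * X + C (1 - y i)).roots = {(y i - 1) / y i} := by
      rw [show (C (y i) * X + C (1 - y i)) = C (y i) * (X - C ((y i - 1) / y i)) by
        rw [mul_sub, ← C_mul, mul_div_cancel₀ _ hy, C_sub, C_sub]; ring,
        roots_C_mul _ hy, roots_X_sub_C]
    rw [hr, Multiset.filter_singleton]
    by_cases hP : P ((y i - 1) / y i)
    · rw [if_pos hP, if_pos ((h1 i hy).2 hP)]; simp
    · rw [if_neg hP, if_neg fun hq => hP ((h1 i hy).1 hq)]; simp

theorem HasAffineFactors.countP_lt {p : ℝ[X]} (hp : p ≠ 0) {d : ℕ} {y : Fin d → ℝ}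
    (h : HasAffineFactors p y) (hy : ∀ i, y i ∈ Set.Icc (0 : ℝ) 1) (x : ℝ) :
    p.roots.countP (x < ·) = (Finset.univ.filter fun i => affineFactor (y i) x < 0).card := by
  refine h.countP_roots hp (x < ·) (fun y => affineFactor y x < 0) (fun i hi => ?_) fun i hi => ?_
  · simp [affineFactor, hi]
  · rw [lt_div_iff₀ (lt_of_le_of_ne (hy i).1 (Ne.symm hi)), affineFactor]
    constructor <;> intro h <;> linarith

theorem HasAffineFactors.countP_le {p : ℝ[X]} (hp : p ≠ 0) {d : ℕ} {y : Fin d → ℝ}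
    (h : HasAffineFactors p y) (hy : ∀ i, y i ∈ Set.Icc (0 : ℝ) 1) (x : ℝ) :
    p.roots.countP (x ≤ ·) = (Finset.univ.filter fun i => affineFactor (y i) x ≤ 0).card := by
  refine h.countP_roots hp (x ≤ ·) (fun y => affineFactor y x ≤ 0) (fun i hi => ?_) fun i hi => ?_
  · simp [affineFactor, hi]
  · rw [le_div_iff₀ (lt_of_le_of_ne (hy i).1 (Ne.symm hi)), affineFactor]
    constructor <;> intro h <;> linarith

theorem countP_le_eq (s : Multiset ℝ) (x : ℝ) :
    s.countP (x ≤ ·) = s.countP (x < ·) + s.count x := by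
  induction s using Multiset.induction with
  | empty => simp
  | cons a s ih =>
    rw [Multiset.countP_cons, Multiset.countP_cons, Multiset.count_cons, ih]
    rcases lt_trichotomy x a with h | h | h
    · rw [if_pos h.le, if_pos h, if_neg h.ne]; omega
    · rw [if_pos h.le, if_neg h.not_lt, if_pos h]; omega
    · rw [if_neg h.not_ge, if_neg h.not_gt, if_neg h.ne']; omega

section Segment

variable {f g : ℝ[X]}

/-- The segment of polynomials from `f` to `g`. -/
noncomputable def segmentPoly (f g : ℝ[X]) (s : ℝ) : ℝ[X] := C (1 - s) * f + C s * g

theorem eval_segmentPoly (f g : ℝ[X]) (s t : ℝ) :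
    (segmentPoly f g s).eval t = (1 - s) * f.eval t + s * g.eval t := by
  simp [segmentPoly]

theorem segmentPoly_coeff_nonneg (hf : ∀ k, 0 ≤ f.coeff k) (hg : ∀ k, 0 ≤ g.coeff k) {s : ℝ}
    (hs : s ∈ Set.Icc (0 : ℝ) 1) (k : ℕ) : 0 ≤ (segmentPoly f g s).coeff k := by
  rw [segmentPoly, coeff_add, coeff_C_mul, coeff_C_mul]
  exact add_nonneg (mul_nonneg (sub_nonneg.2 hs.2) (hf k)) (mul_nonneg hs.1 (hg k))

theorem segmentPoly_ne_zero (hf0 : f ≠ 0) (hg0 : g ≠ 0) (hf : ∀ k, 0 ≤ f.coeff k)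
    (hg : ∀ k, 0 ≤ g.coeff k) {s : ℝ} (hs : s ∈ Set.Icc (0 : ℝ) 1) :
    segmentPoly f g s ≠ 0 := by
  intro h
  have h1 := eval_segmentPoly f g s 1
  rw [h, eval_zero] at h1
  have h2 := eval_one_pos_of_coeff_nonneg hf0 hf
  have h3 := eval_one_pos_of_coeff_nonneg hg0 hg
  have h4 := mul_nonneg (sub_nonneg.2 hs.2) h2.le
  have h5 := mul_nonneg hs.1 h3.le
  rcases hs.1.eq_or_lt with rfl | h6
  · linarith
  · have := mul_pos h6 h3; linarith

theorem natDegree_segmentPoly_le (f g : ℝ[X]) (s : ℝ) :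
    (segmentPoly f g s).natDegree ≤ max f.natDegree g.natDegree :=
  (natDegree_add_le _ _).trans (max_le_max (natDegree_C_mul_le _ _) (natDegree_C_mul_le _ _))

/-- It is the projection of a compact set of pairs `(s, y)`. -/
theorem isClosed_segment_factors (f g : ℝ[X]) {d : ℕ} {T : Set (Fin d → ℝ)} (hT : IsClosed T) :
    IsClosed {s : ℝ | s ∈ Set.Icc (0 : ℝ) 1 ∧ ∃ y : Fin d → ℝ, (∀ i, y i ∈ Set.Icc (0 : ℝ) 1) ∧
      HasAffineFactors (segmentPoly f g s) y ∧ y ∈ T} := by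
  have hcl : IsClosed {q : ℝ × (Fin d → ℝ) | HasAffineFactors (segmentPoly f g q.1) q.2} := by
    simp only [HasAffineFactors, Set.ofPred_forall, eval_segmentPoly, affineFactor]
    exact isClosed_iInter fun t => isClosed_eq (by fun_prop) (by fun_prop)
  have hc : IsCompact ((Set.Icc (0 : ℝ) 1 ×ˢ Set.univ.pi fun _ : Fin d => Set.Icc (0 : ℝ) 1) ∩
      ({q | HasAffineFactors (segmentPoly f g q.1) q.2} ∩ Prod.snd ⁻¹' T)) :=
    (isCompact_Icc.prod (isCompact_univ_pi fun _ => isCompact_Icc)).inter_right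
      (hcl.inter (hT.preimage continuous_snd))
  convert (hc.image continuous_fst).isClosed using 1
  ext s
  simp only [Set.mem_ofPred_eq, Set.mem_image, Set.mem_inter_iff, Set.mem_prod, Set.mem_univ_pi,
    Set.mem_preimage, Prod.exists]
  constructor
  · rintro ⟨hs, y, hy, h1, h2⟩
    exact ⟨s, y, ⟨⟨hs, hy⟩, h1, h2⟩, rfl⟩
  · rintro ⟨s, y, ⟨⟨hs, hy⟩, h1, h2⟩, rfl⟩
    exact ⟨hs, y, hy, h1, h2⟩

theorem continuous_affineFactor {d : ℕ} (i : Fin d) (x : ℝ) :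
    Continuous fun y : Fin d → ℝ => affineFactor (y i) x := by
  simp only [affineFactor]; fun_prop

theorem isClosed_card_neg_le {d : ℕ} (x : ℝ) (v : ℕ) : IsClosed {y : Fin d → ℝ |
    (Finset.univ.filter fun i => affineFactor (y i) x < 0).card ≤ v} := by
  have : {y : Fin d → ℝ | (Finset.univ.filter fun i => affineFactor (y i) x < 0).card ≤ v} =
      ⋃ I ∈ {I : Finset (Fin d) | I.card ≤ v}, {y | ∀ i, i ∉ I → 0 ≤ affineFactor (y i) x} := by
    ext y
    simp only [Set.mem_ofPred_eq, Set.mem_iUnion, exists_prop]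
    constructor
    · exact fun h => ⟨_, h, fun i hi => by simpa using hi⟩
    · rintro ⟨I, hI, h⟩
      refine (Finset.card_le_card fun i hi => ?_).trans hI
      by_contra hn
      exact absurd (h i hn) (not_le.2 (Finset.mem_filter.1 hi).2)
  rw [this]
  refine (Set.toFinite _).isClosed_biUnion fun I _ => ?_
  simp only [Set.ofPred_forall]
  exact isClosed_iInter fun i => isClosed_iInter fun _ =>
    isClosed_le continuous_const (continuous_affineFactor i x)

theorem isClosed_le_card_nonpos {d : ℕ} (x : ℝ) (v : ℕ) : IsClosed {y : Fin d → ℝ |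
    v ≤ (Finset.univ.filter fun i => affineFactor (y i) x ≤ 0).card} := by
  have : {y : Fin d → ℝ | v ≤ (Finset.univ.filter fun i => affineFactor (y i) x ≤ 0).card} =
      ⋃ I ∈ {I : Finset (Fin d) | v ≤ I.card}, {y | ∀ i, i ∈ I → affineFactor (y i) x ≤ 0} := by
    ext y
    simp only [Set.mem_ofPred_eq, Set.mem_iUnion, exists_prop]
    constructor
    · exact fun h => ⟨_, h, fun i hi => by simpa using hi⟩
    · rintro ⟨I, hI, h⟩
      exact hI.trans (Finset.card_le_card fun i hi => by simpa using h i hi)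
  rw [this]
  refine (Set.toFinite _).isClosed_biUnion fun I _ => ?_
  simp only [Set.ofPred_forall]
  exact isClosed_iInter fun i => isClosed_iInter fun _ =>
    isClosed_le (continuous_affineFactor i x) continuous_const

/-- The parameters with at most `v` roots beyond `x`, and those with at least `v + 1` roots from `x`
on, form closed sets covering `[0, 1]`. Both are nonempty, so by connectedness they meet. -/
theorem exists_segmentPoly_crossing (hf0 : f ≠ 0) (hg0 : g ≠ 0) (hf : ∀ k, 0 ≤ f.coeff k)
    (hg : ∀ k, 0 ≤ g.coeff k) (hs : ∀ s ∈ Set.Icc (0 : ℝ) 1, (segmentPoly f g s).Splits)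
    {x : ℝ} {v : ℕ} (h0 : f.roots.countP (x < ·) ≤ v) (h1 : v + 1 ≤ g.roots.countP (x ≤ ·)) :
    ∃ s ∈ Set.Icc (0 : ℝ) 1, (segmentPoly f g s).roots.countP (x < ·) ≤ v ∧
      v + 1 ≤ (segmentPoly f g s).roots.countP (x ≤ ·) := by
  have hne := fun s hs => segmentPoly_ne_zero hf0 hg0 hf hg (s := s) hs
  have hrep : ∀ s ∈ Set.Icc (0 : ℝ) 1, ∃ y : Fin (max f.natDegree g.natDegree) → ℝ,
      (∀ i, y i ∈ Set.Icc (0 : ℝ) 1) ∧ HasAffineFactors (segmentPoly f g s) y := fun s h =>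
    exists_hasAffineFactors (hs s h) (segmentPoly_coeff_nonneg hf hg h)
      (natDegree_segmentPoly_le f g s)
  have hA := isClosed_segment_factors f g
    (isClosed_card_neg_le (d := max f.natDegree g.natDegree) x v)
  have hB := isClosed_segment_factors f g
    (isClosed_le_card_nonpos (d := max f.natDegree g.natDegree) x (v + 1))
  have hcover := isPreconnected_closed_iff.1 (isPreconnected_Icc (a := (0 : ℝ)) (b := 1))
    _ _ hA hB (fun s h => by
      obtain ⟨y, hy, hyf⟩ := hrep s h
      rcases Nat.lt_or_ge v (Finset.univ.filter fun i => affineFactor (y i) x < 0).card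
        with hv | hv
      · refine Or.inr ⟨h, y, hy, hyf, hv.trans_le (Finset.card_le_card fun i hi => ?_)⟩
        simp only [Finset.mem_filter, Finset.mem_univ, true_and] at hi ⊢
        exact hi.le
      · exact Or.inl ⟨h, y, hy, hyf, hv⟩)
  have hm0 : (0 : ℝ) ∈ Set.Icc (0 : ℝ) 1 := by simp
  have hm1 : (1 : ℝ) ∈ Set.Icc (0 : ℝ) 1 := by simp
  obtain ⟨y, hy, hyf⟩ := hrep 0 hm0
  obtain ⟨z, hz, hzf⟩ := hrep 1 hm1
  obtain ⟨s, hs1, hsA, hsB⟩ := hcover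
    ⟨0, hm0, hm0, y, hy, hyf, by
      rw [Set.mem_ofPred_eq, ← hyf.countP_lt (hne 0 hm0) hy]
      simpa [segmentPoly] using h0⟩
    ⟨1, hm1, hm1, z, hz, hzf, by
      rw [Set.mem_ofPred_eq, ← hzf.countP_le (hne 1 hm1) hz]
      simpa [segmentPoly] using h1⟩
  -- The slopes `y` and `z` may differ, but both describe the same polynomial, whose root counts do
  -- not depend on the choice.
  obtain ⟨_, y, hy, hyf, hyT⟩ := hsA
  obtain ⟨_, z, hz, hzf, hzT⟩ := hsB
  refine ⟨s, hs1, ?_, ?_⟩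
  · rw [hyf.countP_lt (hne s hs1) hy]; exact hyT
  · rw [hzf.countP_le (hne s hs1) hz]; exact hzT

/-- A gap of two would give crossings of `x` at two consecutive levels. As `f.eval x ≠ 0`, only one
parameter makes `x` a root, so both crossings happen there and `x` is a multiple root; then the
Wronskian vanishes at `x`. -/
theorem countP_roots_le_of_generic (hf0 : f ≠ 0) (hg0 : g ≠ 0) (hf : ∀ k, 0 ≤ f.coeff k)
    (hg : ∀ k, 0 ≤ g.coeff k) (hs : ∀ s ∈ Set.Icc (0 : ℝ) 1, (segmentPoly f g s).Splits)
    {x : ℝ} (hx : f.eval x ≠ 0) (hw : (f * derivative g - derivative f * g).eval x ≠ 0) :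
    g.roots.countP (x ≤ ·) ≤ f.roots.countP (x < ·) + 1 := by
  by_contra! hlt
  obtain ⟨s, hs1, hsA, hsB⟩ := exists_segmentPoly_crossing hf0 hg0 hf hg hs le_rfl
    (show f.roots.countP (x < ·) + 1 ≤ g.roots.countP (x ≤ ·) by omega)
  obtain ⟨t, ht1, htA, htB⟩ := exists_segmentPoly_crossing hf0 hg0 hf hg hs
    (show f.roots.countP (x < ·) ≤ f.roots.countP (x < ·) + 1 by omega) hlt
  rw [countP_le_eq] at hsB htB
  have root : ∀ s, 0 < (segmentPoly f g s).roots.count x →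
      (1 - s) * f.eval x + s * g.eval x = 0 := fun s h => by
    rw [← eval_segmentPoly]
    exact isRoot_of_mem_roots (Multiset.count_pos.1 h)
  have h1 := root s (by omega)
  have h2 := root t (by omega)
  have hst : s = t := by
    by_contra hne
    have h3 : (s - t) * (g.eval x - f.eval x) = 0 := by linear_combination h1 - h2
    have h4 := (mul_eq_zero.1 h3).resolve_left (sub_ne_zero.2 hne)
    apply hx
    linear_combination h1 - s * h4
  subst hst
  have hm : 1 < (segmentPoly f g s).rootMultiplicity x := by rw [← count_roots]; omega
  have h3 := (one_lt_rootMultiplicity_iff_isRoot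
    (segmentPoly_ne_zero hf0 hg0 hf hg hs1)).1 hm |>.2
  have h4 : (1 - s) * (derivative f).eval x + s * (derivative g).eval x = 0 := by
    have := h3
    simpa [segmentPoly, IsRoot] using this
  apply hw
  rw [eval_sub, eval_mul, eval_mul]
  rcases eq_or_ne s 0 with rfl | hs0
  · exact absurd (by simpa using h1) hx
  · refine (mul_eq_zero.1 (?_ : s * _ = 0)).resolve_left hs0
    linear_combination f.eval x * h4 - (derivative f).eval x * h1

/-- Otherwise `u = f - c * g`, with `c` chosen so that `u` vanishes at `a`, satisfies `u' * g = u *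
g'`. As `g` does not vanish at `a`, the multiplicity of `a` is smaller on the left than on the
right. -/
theorem eq_C_mul_of_wronskian_eq_zero {a : ℝ} (ha : g.eval a ≠ 0)
    (h : f * derivative g - derivative f * g = 0) : f = C (f.eval a / g.eval a) * g := by
  by_contra hne
  set u := f - C (f.eval a / g.eval a) * g with hu
  have hu0 : u ≠ 0 := sub_ne_zero.2 hne
  have hua : u.IsRoot a := by simp [hu, ha]
  have hw : derivative u * g = u * derivative g := by
    have : derivative u = derivative f - C (f.eval a / g.eval a) * derivative g := by
      simp [hu]
    rw [this, hu]; linear_combination -h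
  have hg0 : g ≠ 0 := by rintro rfl; simp at ha
  have hdu : derivative u ≠ 0 := by
    intro h0
    obtain ⟨c, hc⟩ := natDegree_eq_zero.1 (derivative_eq_zero.1 h0)
    rw [← hc] at hua hu0
    simp at hua
    exact hu0 (by rw [hua, C_0])
  have hdg : u * derivative g ≠ 0 := by rw [← hw]; exact mul_ne_zero hdu hg0
  have h1 := congrArg (rootMultiplicity a) hw
  rw [rootMultiplicity_mul (mul_ne_zero hdu hg0), rootMultiplicity_mul hdg,
    derivative_rootMultiplicity_of_root hua,
    rootMultiplicity_eq_zero (p := g) ha] at h1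
  have := (rootMultiplicity_pos hu0).2 hua
  omega

theorem countP_lt_eventually_eq (s : Multiset ℝ) (x : ℝ) :
    ∀ᶠ z in 𝓝[>] x, s.countP (z < ·) = s.countP (x < ·) := by
  induction s using Multiset.induction with
  | empty => simp
  | cons a s ih =>
    have h1 : ∀ᶠ z in 𝓝[>] x, (z < a ↔ x < a) := by
      rcases lt_or_ge x a with h | h
      · filter_upwards [Ioo_mem_nhdsGT h] with z hz
        exact ⟨fun _ => h, fun _ => hz.2⟩
      · filter_upwards [self_mem_nhdsWithin] with z hz
        have hz : x < z := hz
        exact ⟨fun h' => by linarith, fun h' => by linarith⟩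
    filter_upwards [ih, h1] with z hz hz1
    simp only [Multiset.countP_cons, hz, hz1]

theorem eventually_eval_ne_zero {p : ℝ[X]} (hp : p ≠ 0) (x : ℝ) :
    ∀ᶠ z in 𝓝[>] x, p.eval z ≠ 0 := by
  have h1 : ∀ᶠ z in 𝓝 x, z ∉ (p.roots.toFinset.erase x : Set ℝ) :=
    (p.roots.toFinset.erase x).finite_toSet.isClosed.isOpen_compl.mem_nhds (by simp)
  filter_upwards [nhdsWithin_le_nhds h1, self_mem_nhdsWithin] with z hz hxz h0
  exact hz (by simpa [hp] using ⟨h0, (Set.mem_Ioi.1 hxz).ne'⟩)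

/-- If `f` and `g` have nonnegative coefficients and every polynomial on the segment from `f` to `g`
is real-rooted, then on each half-line `g` has at most one root more than `f`. -/
theorem countP_roots_lt_le (hf0 : f ≠ 0) (hg0 : g ≠ 0) (hf : ∀ k, 0 ≤ f.coeff k)
    (hg : ∀ k, 0 ≤ g.coeff k) (hs : ∀ s ∈ Set.Icc (0 : ℝ) 1, (segmentPoly f g s).Splits)
    (x : ℝ) : g.roots.countP (x < ·) ≤ f.roots.countP (x < ·) + 1 := by
  by_cases hw : f * derivative g - derivative f * g = 0
  · have h1 := eval_one_pos_of_coeff_nonneg hf0 hf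
    have h2 := eval_one_pos_of_coeff_nonneg hg0 hg
    rw [eq_C_mul_of_wronskian_eq_zero h2.ne' hw, roots_C_mul _ (div_pos h1 h2).ne']
    omega
  · obtain ⟨z, hz1, hz2, hz3, hz4⟩ := ((countP_lt_eventually_eq f.roots x).and
      ((countP_lt_eventually_eq g.roots x).and ((eventually_eval_ne_zero hf0 x).and
        (eventually_eval_ne_zero hw x)))).exists
    rw [← hz1, ← hz2]
    have := countP_roots_le_of_generic hf0 hg0 hf hg hs hz3 hz4
    rw [countP_le_eq] at this
    omega

end Segment

end RootCounting

/-! ### Interlacing as a comparison of root counts -/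

section CountingLists

theorem getElem_iff_lt_countP {P : ℝ → Prop} [DecidablePred P] (hP : ∀ a b, a ≤ b → P a → P b)
    {l : List ℝ} (hl : l.Pairwise (· ≥ ·)) {i : ℕ} (hi : i < l.length) :
    P l[i] ↔ i < l.countP (fun a => decide (P a)) := by
  induction l generalizing i with
  | nil => simp at hi
  | cons a l ih =>
    rw [List.pairwise_cons] at hl
    have hnot : ¬ P a → l.countP (fun a => decide (P a)) = 0 := fun ha => by
      rw [List.countP_eq_zero]
      intro b hb
      simpa using fun h => ha (hP _ _ (hl.1 b hb) h)
    rw [List.countP_cons]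
    rcases i with _ | i
    · by_cases ha : P a
      · simp [ha]
      · simp [ha, hnot ha]
    · have hi' : i < l.length := by simpa using hi
      rw [List.getElem_cons_succ, ih hl.2 hi']
      by_cases ha : P a
      · simp [ha]
      · simp [ha, hnot ha]

theorem length_rootList (p : ℝ[X]) : (rootList p).length = p.roots.card := by
  simp [rootList]

theorem le_getElem_rootList_iff (p : ℝ[X]) (x : ℝ) {i : ℕ} (hi : i < (rootList p).length) :
    x ≤ (rootList p)[i] ↔ i < p.roots.countP (x ≤ ·) := by
  have h1 : (rootList p).Pairwise (· ≥ ·) := Multiset.pairwise_sort _ _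
  rw [getElem_iff_lt_countP (P := (x ≤ ·)) (fun a b hab h => h.trans hab) h1 hi]
  have h2 : p.roots = (rootList p : Multiset ℝ) := (Multiset.sort_eq _ _).symm
  conv_rhs => rw [h2]
  rw [Multiset.coe_countP]

/-- On each half-line the multiset `s` has as many elements as `t`, or one more. -/
def Alternates (s t : Multiset ℝ) : Prop :=
  ∀ x, t.countP (x ≤ ·) ≤ s.countP (x ≤ ·) ∧ s.countP (x ≤ ·) ≤ t.countP (x ≤ ·) + 1

theorem exists_countP_le_eq_card (s t : Multiset ℝ) :
    ∃ x : ℝ, s.countP (x ≤ ·) = s.card ∧ t.countP (x ≤ ·) = t.card := by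
  obtain ⟨x, hx⟩ := (s + t).toFinset.bddBelow
  refine ⟨x, Multiset.countP_eq_card.2 fun a ha => hx ?_,
    Multiset.countP_eq_card.2 fun a ha => hx ?_⟩ <;> simp [ha]

/-- In a decreasing list, entry `i` is at least `x` exactly when more than `i` entries are; this
translates between the two sides. -/
theorem alternates_iff (p q : ℝ[X]) : Alternates p.roots q.roots ↔
    (p.roots.card = q.roots.card ∨ p.roots.card = q.roots.card + 1) ∧
    (∀ (i : ℕ) (_ : i < (rootList p).length) (_ : i < (rootList q).length),
      (rootList q)[i] ≤ (rootList p)[i]) ∧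
    (∀ (i : ℕ) (_ : i + 1 < (rootList p).length) (_ : i < (rootList q).length),
      (rootList p)[i + 1] ≤ (rootList q)[i]) := by
  constructor
  · intro h
    refine ⟨?_, fun i hp hq => ?_, fun i hp hq => ?_⟩
    · obtain ⟨x, h1, h2⟩ := exists_countP_le_eq_card p.roots q.roots
      have := h x
      omega
    · rw [le_getElem_rootList_iff]
      exact lt_of_lt_of_le ((le_getElem_rootList_iff q _ hq).1 le_rfl) (h _).1
    · rw [le_getElem_rootList_iff]
      have h1 := (le_getElem_rootList_iff p _ hp).1 le_rfl
      have h2 := (h (rootList p)[i + 1]).2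
      omega
  · rintro ⟨h0, h1, h2⟩ x
    rw [← length_rootList, ← length_rootList] at h0
    have hcp : p.roots.countP (x ≤ ·) ≤ (rootList p).length := by
      rw [length_rootList]; exact Multiset.countP_le_card _ _
    have hcq : q.roots.countP (x ≤ ·) ≤ (rootList q).length := by
      rw [length_rootList]; exact Multiset.countP_le_card _ _
    constructor
    · by_contra! hlt
      have hq : q.roots.countP (x ≤ ·) - 1 < (rootList q).length := by omega
      have hp : q.roots.countP (x ≤ ·) - 1 < (rootList p).length := by omega
      have h3 := (le_getElem_rootList_iff q x hq).2 (by omega)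
      have h4 := (le_getElem_rootList_iff p x hp).1 (h3.trans (h1 _ hp hq))
      omega
    · by_contra! hlt
      obtain ⟨c, hc⟩ : ∃ c, p.roots.countP (x ≤ ·) = c + 2 :=
        ⟨p.roots.countP (x ≤ ·) - 2, by omega⟩
      have hp : c + 1 < (rootList p).length := by omega
      have hq : c < (rootList q).length := by omega
      have h3 := (le_getElem_rootList_iff p x hp).2 (by omega)
      have h4 := (le_getElem_rootList_iff q x hq).1 (h3.trans (h2 _ hp hq))
      omega

theorem interlaces_iff {p q : ℝ[X]} (hq : q ≠ 0) :
    Interlaces p q ↔ p ≠ 0 ∧ p.Splits ∧ q.Splits ∧ Alternates p.roots q.roots := by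
  rw [Interlaces, RealRooted, RealRooted]
  constructor
  · rintro (⟨h, _⟩ | ⟨⟨hp0, hp⟩, ⟨_, hqs⟩, h⟩)
    · exact absurd h hq
    · rw [hp.natDegree_eq_card_roots, hqs.natDegree_eq_card_roots] at h
      exact ⟨hp0, hp, hqs, (alternates_iff p q).2 h⟩
  · rintro ⟨hp0, hp, hqs, h⟩
    rw [alternates_iff, ← hp.natDegree_eq_card_roots, ← hqs.natDegree_eq_card_roots] at h
    exact Or.inr ⟨⟨hp0, hp⟩, ⟨hq, hqs⟩, h⟩

theorem exists_countP_lt_eq_countP_le (s t : Multiset ℝ) (x : ℝ) :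
    ∃ z < x, s.countP (z < ·) = s.countP (x ≤ ·) ∧ t.countP (z < ·) = t.countP (x ≤ ·) := by
  have key : ∀ s : Multiset ℝ, ∀ᶠ z in 𝓝[<] x, s.countP (z < ·) = s.countP (x ≤ ·) := by
    intro s
    induction s using Multiset.induction with
    | empty => simp
    | cons a s ih =>
      have h1 : ∀ᶠ z in 𝓝[<] x, (z < a ↔ x ≤ a) := by
        rcases lt_or_ge a x with h | h
        · filter_upwards [Ioo_mem_nhdsLT h] with z hz
          exact ⟨fun h' => by linarith [hz.1], fun h' => by linarith⟩
        · filter_upwards [self_mem_nhdsWithin] with z hz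
          have hz : z < x := hz
          exact ⟨fun _ => h, fun _ => by linarith⟩
      filter_upwards [ih, h1] with z hz hz1
      simp only [Multiset.countP_cons, hz, hz1]
  obtain ⟨z, h1, h2, h3⟩ := ((key s).and ((key t).and self_mem_nhdsWithin)).exists
  exact ⟨z, h3, h1, h2⟩

/-- A closed half-line meets finite multisets as a slightly larger open one does. Only negative `x`
are needed, which leaves room for the extra root `0` of `X * p₀` and for inversion. -/
theorem alternates_of_countP_lt {s t : Multiset ℝ} (hs : ∀ a ∈ s, a ≤ 0) (ht : ∀ a ∈ t, a ≤ 0)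
    (h : ∀ x < 0, t.countP (x < ·) ≤ s.countP (x < ·) ∧
      s.countP (x < ·) ≤ t.countP (x < ·) + 1) : Alternates s t := by
  have h0 : ∀ s : Multiset ℝ, (∀ a ∈ s, a ≤ 0) → ∀ x : ℝ, 0 ≤ x → s.countP (x < ·) = 0 :=
    fun s hs x hx => Multiset.countP_eq_zero.2 fun a ha => not_lt.2 ((hs a ha).trans hx)
  intro x
  obtain ⟨z, -, h1, h2⟩ := exists_countP_lt_eq_countP_le s t x
  rw [← h1, ← h2]
  rcases lt_or_ge z 0 with hz | hz
  · exact h z hz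
  · rw [h0 s hs z hz, h0 t ht z hz]; omega

theorem Alternates.countP_lt {s t : Multiset ℝ} (h : Alternates s t) (x : ℝ) :
    t.countP (x < ·) ≤ s.countP (x < ·) ∧ s.countP (x < ·) ≤ t.countP (x < ·) + 1 := by
  have key : ∃ z > x, s.countP (x < ·) = s.countP (z ≤ ·) ∧
      t.countP (x < ·) = t.countP (z ≤ ·) := by
    obtain ⟨z, h1, h2, h3⟩ := ((countP_lt_eventually_eq s x).and
      ((countP_lt_eventually_eq t x).and self_mem_nhdsWithin)).exists
    have h3 : x < z := h3
    have sand : ∀ s : Multiset ℝ, s.countP (z < ·) = s.countP (x < ·) →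
        s.countP (x < ·) = s.countP (z ≤ ·) := fun s hs => by
      refine le_antisymm ?_ ?_
      · rw [← hs, countP_le_eq]; omega
      · rw [Multiset.countP_eq_card_filter, Multiset.countP_eq_card_filter]
        exact Multiset.card_le_card (Multiset.monotone_filter_right _ fun a ha => h3.trans_le ha)
    exact ⟨z, h3, sand s h1, sand t h2⟩
  obtain ⟨z, -, h1, h2⟩ := key
  rw [h1, h2]
  exact h z

end CountingLists

/-! ### Reversed polynomials and inverted roots -/

section Reversal

theorem reverse_one : (1 : ℝ[X]).reverse = 1 := by
  simpa using reverse_C (1 : ℝ)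

theorem reverse_X_sub_C (r : ℝ) : (X - C r : ℝ[X]).reverse = C (-r) * X + C 1 := by
  have h1 : (X : ℝ[X]).reverse = 1 := by
    simpa [reverse_one] using reverse_mul_X (1 : ℝ[X])
  rw [sub_eq_add_neg, ← C_neg, reverse_add_C, h1, natDegree_X, pow_one, C_1, add_comm]

theorem splits_reverse {p : ℝ[X]} (hp : p.Splits) : p.reverse.Splits := by
  rw [hp.eq_prod_roots, reverse_mul_of_domain, reverse_C]
  refine (Splits.C _).mul ?_
  induction p.roots using Multiset.induction with
  | empty => simp [reverse_one]
  | cons r s ih =>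
    rw [Multiset.map_cons, Multiset.prod_cons, reverse_mul_of_domain, reverse_X_sub_C]
    exact (Splits.of_natDegree_le_one natDegree_linear_le).mul ih

theorem splits_of_splits_reverse {p : ℝ[X]} (hp : p.reverse.Splits) : p.Splits := by
  rw [← mirror_mirror p, mirror, mirror, reverse_mul_X_pow]
  exact (splits_reverse hp).mul (Splits.X_pow _)

/-- Inversion reverses the order of negative numbers, so each negative root is counted in exactly
one term. A root at `0` is lost in the reversal but counted in the second term. -/
theorem countP_roots_reverse {p : ℝ[X]} (hp : p.Splits) (hp0 : p ≠ 0) {y : ℝ} (hy : y < 0)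
    (hr : ∀ r ∈ p.roots, r ≤ 0) :
    p.reverse.roots.countP (y ≤ ·) + p.roots.countP (y⁻¹ < ·) = p.natDegree := by
  have hlead : p.leadingCoeff ≠ 0 := leadingCoeff_ne_zero.2 hp0
  have h1 : p.reverse.roots = ((p.roots.map fun r => X - C r).prod).reverse.roots := by
    conv_lhs => rw [hp.eq_prod_roots, reverse_mul_of_domain, reverse_C, roots_C_mul _ hlead]
  rw [h1, hp.natDegree_eq_card_roots]
  clear h1
  revert hr
  induction p.roots using Multiset.induction with
  | empty => simp [reverse_one]
  | cons r s ih =>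
    intro hr
    have hr0 : r ≤ 0 := hr r (Multiset.mem_cons_self r s)
    have hs := ih fun r hr' => hr r (Multiset.mem_cons_of_mem hr')
    have hm : (X - C r : ℝ[X]).reverse * ((s.map fun r => X - C r).prod).reverse ≠ 0 :=
      mul_ne_zero (by rw [Ne, reverse_eq_zero]; exact X_sub_C_ne_zero r) (by
        rw [Ne, reverse_eq_zero]
        exact (monic_multiset_prod_of_monic _ _ fun r _ => monic_X_sub_C r).ne_zero)
    rw [Multiset.map_cons, Multiset.prod_cons, reverse_mul_of_domain, roots_mul hm,
      Multiset.countP_add, Multiset.countP_cons, Multiset.card_cons, reverse_X_sub_C]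
    have key : (C (-r) * X + C 1 : ℝ[X]).roots.countP (y ≤ ·) +
        (if y⁻¹ < r then 1 else 0) = 1 := by
      rcases hr0.eq_or_lt with rfl | hr0
      · simp [hy]
      · have h2 : (C (-r) * X + C 1 : ℝ[X]) = C (-r) * (X - C r⁻¹) := by
          rw [mul_sub, ← C_mul, neg_mul, mul_inv_cancel₀ hr0.ne, C_neg, C_neg, sub_neg_eq_add]
        rw [h2, roots_C_mul _ (neg_ne_zero.2 hr0.ne), roots_X_sub_C,
          ← Multiset.cons_zero, Multiset.countP_cons]
        have h3 : y⁻¹ < r ↔ ¬ y ≤ r⁻¹ := by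
          rw [not_le, inv_lt_of_neg hy hr0]
        by_cases h4 : y ≤ r⁻¹
        · rw [if_pos h4, if_neg (by rw [h3]; simpa using h4)]; simp
        · rw [if_neg h4, if_pos (h3.2 h4)]; simp
    omega

theorem coeff_reverse_nonneg {p : ℝ[X]} (h : ∀ k, 0 ≤ p.coeff k) (k : ℕ) :
    0 ≤ p.reverse.coeff k := by
  rw [coeff_reverse]; exact h _

theorem countP_roots_reverse_of_nonneg {p : ℝ[X]} (hp0 : p ≠ 0) (h : ∀ k, 0 ≤ p.coeff k)
    {y : ℝ} (hy : 0 ≤ y) : p.reverse.roots.countP (y ≤ ·) = 0 := by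
  refine Multiset.countP_eq_zero.2 fun a ha hya => ?_
  have h1 := le_zero_of_mem_roots_of_coeff_nonneg (coeff_reverse_nonneg h) ha
  obtain rfl : a = 0 := le_antisymm h1 (hy.trans hya)
  have h2 : p.reverse.eval 0 = 0 := isRoot_of_mem_roots ha
  rw [← coeff_zero_eq_eval_zero, coeff_zero_reverse, leadingCoeff_eq_zero] at h2
  exact hp0 h2

/-- Interlacing of the reversals in terms of the original polynomials. -/
theorem alternates_reverse_iff {p₀ p₁ : ℝ[X]} (h₀ : ∀ k, 0 ≤ p₀.coeff k)
    (h₁ : ∀ k, 0 ≤ p₁.coeff k) (hp₀ : p₀ ≠ 0) (hp₁ : p₁ ≠ 0) (hs₀ : p₀.Splits) (hs₁ : p₁.Splits)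
    (hd : p₀.natDegree ≤ p₁.natDegree) :
    Alternates (X ^ (p₁.natDegree - p₀.natDegree) * p₀.reverse).roots p₁.reverse.roots ↔
      Alternates p₁.roots p₀.roots := by
  have hr₀ : ∀ r ∈ p₀.roots, r ≤ 0 := fun r => le_zero_of_mem_roots_of_coeff_nonneg h₀
  have hr₁ : ∀ r ∈ p₁.roots, r ≤ 0 := fun r => le_zero_of_mem_roots_of_coeff_nonneg h₁
  have hroots : (X ^ (p₁.natDegree - p₀.natDegree) * p₀.reverse).roots =
      (p₁.natDegree - p₀.natDegree) • {0} + p₀.reverse.roots := by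
    rw [roots_mul (mul_ne_zero (pow_ne_zero _ X_ne_zero) (by simpa using hp₀)), roots_X_pow]
  have hcount : ∀ y : ℝ, (X ^ (p₁.natDegree - p₀.natDegree) * p₀.reverse).roots.countP (y ≤ ·) =
      (p₁.natDegree - p₀.natDegree) * (if y ≤ 0 then 1 else 0) +
        p₀.reverse.roots.countP (y ≤ ·) := fun y => by
    rw [hroots, Multiset.countP_add, Multiset.countP_nsmul, ← Multiset.cons_zero,
      Multiset.countP_cons]
    simp
  constructor
  · intro h
    refine alternates_of_countP_lt hr₁ hr₀ fun x hx => ?_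
    have hy : x⁻¹ < 0 := inv_lt_zero.2 hx
    have e0 := countP_roots_reverse hs₀ hp₀ hy hr₀
    have e1 := countP_roots_reverse hs₁ hp₁ hy hr₁
    -- With the zeros contributed by the power of `X`, both counts equal `p₁.natDegree` minus the
    -- number of original roots beyond `x`.
    have h' := h x⁻¹
    rw [hcount, if_pos hy.le] at h'
    rw [inv_inv] at e0 e1
    omega
  · intro h y
    rw [hcount]
    rcases lt_or_ge y 0 with hy | hy
    · have e0 := countP_roots_reverse hs₀ hp₀ hy hr₀
      have e1 := countP_roots_reverse hs₁ hp₁ hy hr₁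
      have h' := h.countP_lt y⁻¹
      rw [if_pos hy.le]
      omega
    · rw [countP_roots_reverse_of_nonneg hp₀ h₀ hy, countP_roots_reverse_of_nonneg hp₁ h₁ hy]
      have h' := ((alternates_iff p₁ p₀).1 h).1
      rw [← hs₀.natDegree_eq_card_roots, ← hs₁.natDegree_eq_card_roots] at h'
      split_ifs <;> omega

theorem reversal_natDegree_self (p : ℝ[X]) : reversal p.natDegree p = toLaurent p.reverse := by
  rw [reversal, LaurentPolynomial.toLaurent_reverse, mul_comm]

theorem toLaurent_X_pow_mul_reverse {p : ℝ[X]} {d : ℕ} (hd : p.natDegree ≤ d) :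
    toLaurent (X ^ (d - p.natDegree) * p.reverse) = reversal d p := by
  rw [map_mul, toLaurent_X_pow, LaurentPolynomial.toLaurent_reverse, reversal, mul_left_comm,
    ← LaurentPolynomial.T_add,
    mul_comm]
  congr 2
  omega

theorem eq_of_toLaurent_eq_reversal {p q : ℝ[X]} {d : ℕ} (hp : p ≠ 0)
    (h : toLaurent q = reversal d p) :
    p.natDegree ≤ d ∧ q = X ^ (d - p.natDegree) * p.reverse := by
  have h1 : X ^ p.natDegree * q = X ^ d * p.reverse := by
    apply toLaurent_injective
    rw [map_mul, map_mul, toLaurent_X_pow, toLaurent_X_pow, h, LaurentPolynomial.toLaurent_reverse,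
      reversal]
    ring
  have hd : p.natDegree ≤ d := by
    by_contra! hlt
    have h2 := congrArg (fun p => p.coeff d) h1
    simp only [coeff_X_pow_mul', if_neg hlt.not_ge, le_refl, if_true, Nat.sub_self,
      coeff_zero_reverse] at h2
    exact hp (leadingCoeff_eq_zero.1 h2.symm)
  refine ⟨hd, ?_⟩
  refine mul_left_cancel₀ (pow_ne_zero p.natDegree X_ne_zero) ?_
  rw [h1, ← mul_assoc, ← pow_add, Nat.add_sub_cancel' hd]

end Reversal

/-! ### The equivalence -/

section Main

variable {p₀ p₁ : ℝ[X]}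

theorem laurentInterlaces_reversal_iff (h₀ : ∀ k, 0 ≤ p₀.coeff k) (h₁ : ∀ k, 0 ≤ p₁.coeff k)
    (hp₀ : p₀ ≠ 0) (hp₁ : p₁ ≠ 0) :
    LaurentInterlaces (reversal p₁.natDegree p₀) (reversal p₁.natDegree p₁) ↔
      p₀.Splits ∧ p₁.Splits ∧ Alternates p₁.roots p₀.roots := by
  have hrev : p₁.reverse ≠ 0 := by simpa using hp₁
  constructor
  · rintro (⟨h, _⟩ | ⟨p, q, hp, hq, h⟩)
    · rw [reversal_natDegree_self] at h
      exact absurd ((map_eq_zero_iff _ toLaurent_injective).1 h) hrev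
    · rw [reversal_natDegree_self] at hq
      obtain rfl := toLaurent_injective hq
      obtain ⟨hd, rfl⟩ := eq_of_toLaurent_eq_reversal hp₀ hp
      obtain ⟨hne, hsp, hsq, halt⟩ := (interlaces_iff hrev).1 h
      have hs₀ : p₀.Splits := splits_of_splits_reverse (hsp.of_dvd hne (Dvd.intro_left _ rfl))
      have hs₁ : p₁.Splits := splits_of_splits_reverse hsq
      exact ⟨hs₀, hs₁, (alternates_reverse_iff h₀ h₁ hp₀ hp₁ hs₀ hs₁ hd).1 halt⟩
  · rintro ⟨hs₀, hs₁, halt⟩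
    have hd : p₀.natDegree ≤ p₁.natDegree := by
      rw [hs₀.natDegree_eq_card_roots, hs₁.natDegree_eq_card_roots]
      have := ((alternates_iff p₁ p₀).1 halt).1
      omega
    refine Or.inr ⟨_, _, toLaurent_X_pow_mul_reverse hd, (reversal_natDegree_self p₁).symm, ?_⟩
    rw [interlaces_iff hrev]
    exact ⟨mul_ne_zero (pow_ne_zero _ X_ne_zero) (by simpa using hp₀),
      (Splits.X_pow _).mul (splits_reverse hs₀), splits_reverse hs₁,
      (alternates_reverse_iff h₀ h₁ hp₀ hp₁ hs₀ hs₁ hd).2 halt⟩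

theorem eq_ofRoots_rootList {p : ℝ[X]} (hp : p.Splits) :
    p = ofRoots p.leadingCoeff (fun k => (rootList p).getD k 0) (rootList p).length := by
  have h2 : p.roots = (rootList p : Multiset ℝ) := (Multiset.sort_eq _ _).symm
  conv_lhs => rw [hp.eq_prod_roots, h2, Multiset.map_coe, Multiset.prod_coe]
  rw [ofRoots]
  congr 1
  rw [← Fin.prod_univ_eq_prod_range (fun k => X - C ((rootList p).getD k 0)),
    ← List.prod_ofFn]
  congr 1
  refine List.ext_getElem (by simp) fun i h3 h4 => ?_
  simp

/-- The default `0` keeps the bound valid past the end of the list, as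
`isTotallyNonneg_interleave_of_interlacing` requires. -/
theorem rootList_getD_le_zero {p : ℝ[X]} (h : ∀ k, 0 ≤ p.coeff k) (k : ℕ) :
    (rootList p).getD k 0 ≤ 0 := by
  rcases Nat.lt_or_ge k (rootList p).length with hk | hk
  · rw [List.getD_eq_getElem _ _ hk]
    refine le_zero_of_mem_roots_of_coeff_nonneg h ?_
    exact (Multiset.mem_sort _).1 (List.getElem_mem hk)
  · rw [List.getD_eq_default _ _ hk]

theorem isTotallyNonneg_interleave_of_alternates (h₀ : ∀ k, 0 ≤ p₀.coeff k)
    (h₁ : ∀ k, 0 ≤ p₁.coeff k) (hp₀ : p₀ ≠ 0) (hp₁ : p₁ ≠ 0) (hs₀ : p₀.Splits) (hs₁ : p₁.Splits)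
    (halt : Alternates p₁.roots p₀.roots) : IsTotallyNonneg (interleave p₁ p₀) := by
  have hl : ∀ {p : ℝ[X]}, (∀ k, 0 ≤ p.coeff k) → p ≠ 0 → 0 < p.leadingCoeff := fun h hp =>
    lt_of_le_of_ne (h _) (leadingCoeff_ne_zero.2 hp).symm
  obtain ⟨hc, hle₁, hle₂⟩ := (alternates_iff p₁ p₀).1 halt
  rw [← length_rootList, ← length_rootList] at hc
  rw [eq_ofRoots_rootList hs₁, eq_ofRoots_rootList hs₀]
  refine isTotallyNonneg_interleave_of_interlacing (hl h₁ hp₁) (hl h₀ hp₀)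
    (hc.imp Eq.symm id) (rootList_getD_le_zero h₁) (fun k hk hk' => ?_) fun k hk hk' => ?_
  · rw [List.getD_eq_getElem _ _ hk, List.getD_eq_getElem _ _ hk']
    exact hle₁ k hk hk'
  · rw [List.getD_eq_getElem _ _ hk, List.getD_eq_getElem _ _ hk']
    exact hle₂ k hk hk'

theorem splits_of_isTotallyNonneg_toeplitz {p : ℝ[X]} (h : IsTotallyNonneg (toeplitz p)) :
    p.Splits :=
  (initialMinorsNonneg_of_isTotallyNonneg h).splits

theorem alternates_of_isTotallyNonneg_interleave (h₀ : ∀ k, 0 ≤ p₀.coeff k)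
    (h₁ : ∀ k, 0 ≤ p₁.coeff k) (hp₀ : p₀ ≠ 0) (hp₁ : p₁ ≠ 0)
    (h : IsTotallyNonneg (interleave p₁ p₀)) : Alternates p₁.roots p₀.roots := by
  refine alternates_of_countP_lt (fun r => le_zero_of_mem_roots_of_coeff_nonneg h₁)
    (fun r => le_zero_of_mem_roots_of_coeff_nonneg h₀) fun x hx => ⟨?_, ?_⟩
  · have hX : ∀ k, 0 ≤ (X * p₀).coeff k := by
      rintro (_ | k)
      · simp
      · rw [coeff_X_mul]; exact h₀ k
    have hX0 : X * p₀ ≠ 0 := mul_ne_zero X_ne_zero hp₀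
    have := countP_roots_lt_le hp₁ hX0 h₁ hX (fun s hs => splits_of_isTotallyNonneg_toeplitz
      (isTotallyNonneg_toeplitz_add_X_mul (sub_nonneg.2 hs.2) hs.1 h)) x
    rw [roots_mul hX0, roots_X, Multiset.singleton_add, Multiset.countP_cons, if_pos hx] at this
    omega
  · refine countP_roots_lt_le hp₀ hp₁ h₀ h₁ (fun s hs => splits_of_isTotallyNonneg_toeplitz ?_) x
    rw [segmentPoly, add_comm]
    exact isTotallyNonneg_toeplitz_add hs.1 (sub_nonneg.2 hs.2) h

theorem laurentInterlaces_reversal_zero_iff (hp₀ : p₀ ≠ 0) :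
    LaurentInterlaces (reversal 0 p₀) (reversal 0 0) ↔ p₀.Splits := by
  constructor
  · rintro (⟨-, n, p, ⟨hp, hps⟩, h⟩ | ⟨p, q, hp, hq, h⟩)
    · have h1 : LaurentPolynomial.T n * toLaurent p =
          LaurentPolynomial.T (-p₀.natDegree) * toLaurent p₀.reverse := by
        rw [← h, LaurentPolynomial.toLaurent_reverse, reversal, mul_left_comm,
    ← LaurentPolynomial.T_add,
          mul_comm]
        simp
      -- Multiplying by `T (n.natAbs + p₀.natDegree)` clears the negative exponents on both sides.
      obtain ⟨i, hi⟩ : ∃ i : ℕ, (i : ℤ) = n.natAbs + p₀.natDegree + n :=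
        ⟨(n.natAbs + p₀.natDegree + n).toNat, by omega⟩
      have h2 : X ^ i * p = X ^ n.natAbs * p₀.reverse := by
        apply toLaurent_injective
        rw [map_mul, map_mul, toLaurent_X_pow, toLaurent_X_pow, hi, LaurentPolynomial.T_add,
          mul_assoc, h1, ← mul_assoc, ← LaurentPolynomial.T_add]
        simp
      have h3 : (X ^ i * p).Splits := (Splits.X_pow i).mul hps
      rw [h2] at h3
      exact splits_of_splits_reverse (h3.of_dvd
        (mul_ne_zero (pow_ne_zero _ X_ne_zero) (by simpa using hp₀)) (Dvd.intro_left _ rfl))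
    · obtain ⟨hd, rfl⟩ := eq_of_toLaurent_eq_reversal hp₀ hp
      exact Splits.of_natDegree_eq_zero (by omega)
  · intro hs
    refine Or.inl ⟨by simp [reversal], -(p₀.natDegree : ℤ), p₀.reverse,
      ⟨by simpa using hp₀, splits_reverse hs⟩, ?_⟩
    rw [LaurentPolynomial.toLaurent_reverse, reversal, mul_left_comm,
    ← LaurentPolynomial.T_add, mul_comm]
    simp

end Main

theorem corollary4p5 (p₀ p₁ : Polynomial ℝ)
    (h₀ : ∀ k : ℕ, 0 ≤ p₀.coeff k) (h₁ : ∀ k : ℕ, 0 ≤ p₁.coeff k) (hp₀ : p₀ ≠ 0) :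
    IsTotallyNonneg
        (unfolding (!![polyToSeries p₁, polyToSeries p₀] :
          Matrix (Fin 1) (Fin 2) (LaurentSeries ℝ))) ↔
      LaurentInterlaces (reversal p₁.natDegree p₀) (reversal p₁.natDegree p₁) := by
  rw [unfolding_eq_interleave]
  by_cases hp₁ : p₁ = 0
  · subst hp₁
    rw [natDegree_zero, laurentInterlaces_reversal_zero_iff hp₀]
    refine ⟨fun h => splits_of_isTotallyNonneg_toeplitz (isTotallyNonneg_toeplitz_right h),
      fun hs => isTotallyNonneg_interleave_zero_right (isTotallyNonneg_toeplitz_left (g := p₀) ?_)⟩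
    -- Real-rootedness gives a totally nonnegative Toeplitz matrix because `p₀` alternates with
    -- itself.
    exact isTotallyNonneg_interleave_of_alternates h₀ h₀ hp₀ hp₀ hs hs
      fun x => ⟨le_rfl, Nat.le_succ _⟩
  · rw [laurentInterlaces_reversal_iff h₀ h₁ hp₀ hp₁]
    constructor
    · intro h
      exact ⟨splits_of_isTotallyNonneg_toeplitz (isTotallyNonneg_toeplitz_right h),
        splits_of_isTotallyNonneg_toeplitz (isTotallyNonneg_toeplitz_left h),
        alternates_of_isTotallyNonneg_interleave h₀ h₁ hp₀ hp₁ h⟩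
    · rintro ⟨hs₀, hs₁, halt⟩
      exact isTotallyNonneg_interleave_of_alternates h₀ h₁ hp₀ hp₁ hs₀ hs₁ halt
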